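/- Let $M$ be a smooth finite-dimensional manifold (Hausdorff, second countable, without boundary) with a smooth Riemannian metric $\gamma$. Exterior derivatives and wedge products are taken without numerical factors, e.g. $d\xi(X,Y)=X(\xi(Y))-Y(\xi(X))-\xi([X,Y])$ and $\kappa\wedge dt=\kappa\otimes dt-dt\otimes\kappa$, and $\flat_bX=b(X,\cdot)$ for a covariant 2-tensor field $b$. An almost contact metric structure $(F,Z,\xi,\gamma)$ consists of a smooth $F\in\mathrm{End}(TM)$, a smooth vector field $Z$ and a smooth 1-form $\xi$ with $$F^2=-\mathrm{Id}+\xi\otimes Z,\quad \xi\circ F=0,\quad FZ=0,\quad \xi(Z)=1,\quad \gamma(FX,FY)=\gamma(X,Y)-\xi(X)\xi(Y).$$ Its fundamental form is $\Xi(X,Y)=\gamma(FX,Y)$, its derived fundamental form is $L_Z\Xi$, and its associated almost complex structure on $M\times\mathbb R$ (with coordinate $t$ on $\mathbb R$) is $J=F+dt\otimes Z-\xi\otimes\frac{\partial}{\partial t}$. The structure is normal if the Nijenhuis tensor of $J$ vanishes, and Sasakian if it is normal and $\Xi=d\xi$. On a manifold $N$, let $g((X,\alpha),(Y,\beta))=\frac12(\alpha(Y)+\beta(X))$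 on $TN\oplus T^*N$, and let $$[(X,\alpha),(Y,\beta)]=\bigl([X,Y],\,L_X\beta-L_Y\alpha+\tfrac12d(\alpha(Y)-\beta(X))\bigr)$$ be the Courant bracket. A generalized complex structure is a smooth $g$-skew endomorphism $\mathcal J$ of $TN\oplus T^*N$ with $\mathcal J^2=-\mathrm{Id}$ and $$[\mathcal J\mathcal X,\mathcal J\mathcal Y]-\mathcal J[\mathcal X,\mathcal J\mathcal Y]-\mathcal J[\mathcal J\mathcal X,\mathcal Y]+\mathcal J^2[\mathcal X,\mathcal Y]=0$$ for all smooth sections $\mathcal X,\mathcal Y$. A generalized Riemannian metric is a smooth positive definite metric $G$ on $TN\oplus T^*N$ such that the endomorphism $\sharp_G$ defined by $G(\mathcal X,\mathcal Y)=2g(\sharp_G\mathcal X,\mathcal Y)$ is a $g$-isometry with $\sharp_G^2=\mathrm{Id}$. It corresponds to the pair $(\gamma,\psi)$ of a Riemannian metric and a 2-form if the $\pm1$-eigenbundles of $\sharp_G$ are $V_\pm=\{(X,\flat_{\psi\pm\gamma}X)\,:\,X\in TN\}$. A generalized Kähler structure is a pair $(G,\mathcal J)$ with $\sharp_G\mathcal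 J=\mathcal J\sharp_G$ such that $\mathcal J$ and $\sharp_G\circ\mathcal J$ are generalized complex structures. Its induced almost complex structures $J_\pm$ on $N$ are defined by $\mathcal J(X,\flat_{\psi\pm\gamma}X)=(J_\pm X,\flat_{\psi\pm\gamma}J_\pm X)$. A generalized Sasakian structure on $M$ consists of a generalized Riemannian metric $G$ on $M$, corresponding to a pair $(\gamma,\psi)$, and an endomorphism $\mathcal J$ of the bundle $T(M\times\mathbb R)\oplus T^*(M\times\mathbb R)$ such that, for some $\kappa\in\Omega^1(M)$, $(\tilde G,\mathcal J)$ is a generalized Kähler structure on $M\times\mathbb R$ whose induced almost complex structures $J_\pm$ are invariant by the translations along $\mathbb R$; here $\tilde G$ corresponds to the pair $\bigl(e^t(\gamma+dt^2),\,e^t(\psi+\kappa\wedge dt)\bigr)$. A pair $(F_\pm,Z_\pm,\xi_\pm,\gamma)$ of almost contact metric structures corresponds to a generalized Sasakian structure if there is a generalized Sasakian structure on $M$ with metric $\gamma$ whose induced almost complex structures $J_\pm$ are those associated with $(F_\pm,Z_\pm,\xi_\pm)$. **Corollary.** Let $(F_\pm,Z_\pm,\xi_\pm,\gamma)$ be a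 pair of normal almost contact metric structures on $M$ with the same metric $\gamma$. Then, for each of the two structures, $L_{Z_\pm}\Xi_\pm=0$ if and only if $L_{Z_\pm}\gamma=0$. If $L_{Z_+}\Xi_+=0$ and $L_{Z_-}\Xi_-=0$, then the pair corresponds to a generalized Sasakian structure if and only if both structures are Sasakian. -/

import Mathlib

open scoped Manifold ContDiff Bundle

noncomputable section

namespace GenSasaki

/-! ## Smooth tensor fields, exterior derivative, Lie derivative

Tensor fields are given pointwise on the tangent spaces; smoothness is smoothness of the
corresponding section of the bundle. -/

section Calculus

variable {E : Type*} [NormedAddCommGroup E] [NormedSpace ℝ E]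
  {H : Type*} [TopologicalSpace H] (I : ModelWithCorners ℝ E H)
  {N : Type*} [TopologicalSpace N] [ChartedSpace H N]

/-- Vector fields. -/
abbrev VField : Type _ := Π p : N, TangentSpace I p

/-- 1-forms. -/
abbrev OneForm : Type _ := Π p : N, (TangentSpace I p →L[ℝ] ℝ)

/-- Fields of endomorphisms of the tangent bundle. -/
abbrev EndField : Type _ := Π p : N, (TangentSpace I p →L[ℝ] TangentSpace I p)

/-- Covariant 2-tensor fields. -/
abbrev BilinField : Type _ := Π p : N, (TangentSpace I p →L[ℝ] TangentSpace I p →L[ℝ] ℝ)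

section Smooth

variable [IsManifold I ∞ N]

def SmoothVField (X : VField I (N := N)) : Prop :=
  ContMDiff I I.tangent ∞ (fun p => (⟨p, X p⟩ : TangentBundle I N))

def SmoothOneForm (α : OneForm I (N := N)) : Prop :=
  ContMDiff I (I.prod 𝓘(ℝ, E →L[ℝ] ℝ)) ∞
    (fun p => Bundle.TotalSpace.mk' (E →L[ℝ] ℝ)
      (E := fun p : N => TangentSpace I p →L[ℝ] ℝ) p (α p))

def SmoothEndField (F : EndField I (N := N)) : Prop :=
  ContMDiff I (I.prod 𝓘(ℝ, E →L[ℝ] E)) ∞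
    (fun p => Bundle.TotalSpace.mk' (E →L[ℝ] E)
      (E := fun p : N => TangentSpace I p →L[ℝ] TangentSpace I p) p (F p))

def SmoothBilinField (b : BilinField I (N := N)) : Prop :=
  ContMDiff I (I.prod 𝓘(ℝ, E →L[ℝ] E →L[ℝ] ℝ)) ∞
    (fun p => Bundle.TotalSpace.mk' (E →L[ℝ] E →L[ℝ] ℝ)
      (E := fun p : N => TangentSpace I p →L[ℝ] TangentSpace I p →L[ℝ] ℝ) p (b p))

/-- Smooth 2-forms: smooth, alternating covariant 2-tensor fields. -/
structure IsTwoForm (ψ : BilinField I (N := N)) : Prop where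
  alternating : ∀ (p : N) (v : TangentSpace I p), ψ p v v = 0
  smooth : SmoothBilinField I ψ

end Smooth

/-- The differential of a function, as a 1-form. -/
def dFun (f : N → ℝ) : OneForm I (N := N) := fun p => mfderiv I 𝓘(ℝ, ℝ) f p

/-- A 1-form read in the preferred chart at `p` (its pull-back by the inverse of the chart). -/
def oneFormInChart (α : OneForm I (N := N)) (p : N) (y : E) : E →L[ℝ] ℝ :=
  (α ((extChartAt I p).symm y)).comp
    (mfderivWithin 𝓘(ℝ, E) I (extChartAt I p).symm (Set.range I) y)

/-- The exterior derivative of a 1-form, without the factor `1/2`. At `p` it is computed in the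
preferred chart at `p`, where `dα(u, v) = (∂_u α)(v) - (∂_v α)(u)`, and then pulled back to the
manifold. -/
def extDerivOne (α : OneForm I (N := N)) : BilinField I (N := N) := fun p =>
  let D : E →L[ℝ] E →L[ℝ] ℝ :=
    fderivWithin ℝ (oneFormInChart I α p) (Set.range I) (extChartAt I p p)
  let φ : E →L[ℝ] E := mfderiv I 𝓘(ℝ, E) (extChartAt I p) p
  ((D - D.flip).bilinearComp φ φ : E →L[ℝ] E →L[ℝ] ℝ)

/-- The Lie derivative of a 1-form, `L_X β = i(X) dβ + d(β(X))`. -/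
def lieOne (X : VField I (N := N)) (β : OneForm I (N := N)) : OneForm I (N := N) := fun p =>
  extDerivOne I β p (X p) + dFun I (fun q => β q (X q)) p

/-- The Lie derivative of a covariant 2-tensor field, evaluated on two vector fields:
`(L_Z b)(X, Y) = Z(b(X, Y)) - b([Z, X], Y) - b(X, [Z, Y])`. -/
def lieBilin (Z : VField I (N := N)) (b : BilinField I (N := N)) (X Y : VField I (N := N))
    (p : N) : ℝ :=
  dFun I (fun q => b q (X q) (Y q)) p (Z p)
    - b p (VectorField.mlieBracket I Z X p) (Y p)
    - b p (X p) (VectorField.mlieBracket I Z Y p)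

/-- `L_Z b = 0`. -/
def LieBilinVanishes [IsManifold I ∞ N] (Z : VField I (N := N)) (b : BilinField I (N := N)) :
    Prop :=
  ∀ X Y : VField I (N := N), SmoothVField I X → SmoothVField I Y →
    ∀ p, lieBilin I Z b X Y p = 0

/-- The Nijenhuis tensor
`N_J(X, Y) = [JX, JY] - J[X, JY] - J[JX, Y] + J²[X, Y]` on vector fields. -/
def nijenhuis (J : EndField I (N := N)) (X Y : VField I (N := N)) : VField I (N := N) := fun p =>
  VectorField.mlieBracket I (fun q => J q (X q)) (fun q => J q (Y q)) p
    - J p (VectorField.mlieBracket I X (fun q => J q (Y q)) p)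
    - J p (VectorField.mlieBracket I (fun q => J q (X q)) Y p)
    + J p (J p (VectorField.mlieBracket I X Y p))

/-- Vanishing of the Nijenhuis tensor. -/
def NijenhuisVanishes [IsManifold I ∞ N] (J : EndField I (N := N)) : Prop :=
  ∀ X Y : VField I (N := N), SmoothVField I X → SmoothVField I Y →
    ∀ p, nijenhuis I J X Y p = 0

end Calculus

/-! ## Generalized geometry on the big tangent bundle `TN ⊕ T*N` -/

section Generalized

variable {E : Type*} [NormedAddCommGroup E] [NormedSpace ℝ E]
  {H : Type*} [TopologicalSpace H] (I : ModelWithCorners ℝ E H)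
  {N : Type*} [TopologicalSpace N] [ChartedSpace H N]

/-- The fibre of the big tangent bundle. -/
abbrev TBig (p : N) : Type _ := TangentSpace I p × (TangentSpace I p →L[ℝ] ℝ)

/-- Sections of the big tangent bundle. -/
abbrev BigField : Type _ := Π p : N, TBig I p

/-- Fields of endomorphisms of the big tangent bundle. -/
abbrev BigEnd : Type _ := Π p : N, (TBig I p →L[ℝ] TBig I p)

/-- A section `(X, α)` is smooth if both components are. -/
def SmoothBigField [IsManifold I ∞ N] (𝒳 : BigField I (N := N)) : Prop :=
  SmoothVField I (fun p => (𝒳 p).1) ∧ SmoothOneForm I (fun p => (𝒳 p).2)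

/-- An endomorphism field of the big tangent bundle is smooth if it maps smooth sections to
smooth sections. -/
def SmoothBigEnd [IsManifold I ∞ N] (T : BigEnd I (N := N)) : Prop :=
  ∀ 𝒳 : BigField I (N := N), SmoothBigField I 𝒳 → SmoothBigField I (fun p => T p (𝒳 p))

/-- The neutral metric `g((X, α), (Y, β)) = (α(Y) + β(X)) / 2`. -/
def neutral (p : N) (x y : TBig I p) : ℝ := (x.2 y.1 + y.2 x.1) / 2

/-- The Courant bracket
`[(X, α), (Y, β)] = ([X, Y], L_X β - L_Y α + d(α(Y) - β(X)) / 2)`. -/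
def courant (𝒳 𝒴 : BigField I (N := N)) : BigField I (N := N) := fun p =>
  (VectorField.mlieBracket I (fun q => (𝒳 q).1) (fun q => (𝒴 q).1) p,
    lieOne I (fun q => (𝒳 q).1) (fun q => (𝒴 q).2) p
      - lieOne I (fun q => (𝒴 q).1) (fun q => (𝒳 q).2) p
      + (1 / 2 : ℝ) • dFun I (fun q => (𝒳 q).2 (𝒴 q).1 - (𝒴 q).2 (𝒳 q).1) p)

/-- The Courant-Nijenhuis torsion of an endomorphism field of the big tangent bundle. -/
def courantNijenhuis (𝒥 : BigEnd I (N := N)) (𝒳 𝒴 : BigField I (N := N)) :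
    BigField I (N := N) := fun p =>
  courant I (fun q => 𝒥 q (𝒳 q)) (fun q => 𝒥 q (𝒴 q)) p
    - 𝒥 p (courant I 𝒳 (fun q => 𝒥 q (𝒴 q)) p)
    - 𝒥 p (courant I (fun q => 𝒥 q (𝒳 q)) 𝒴 p)
    + 𝒥 p (𝒥 p (courant I 𝒳 𝒴 p))

variable [IsManifold I ∞ N]

/-- Generalized almost complex structures. -/
structure IsGenAlmostComplex (𝒥 : BigEnd I (N := N)) : Prop where
  smooth : SmoothBigEnd I 𝒥
  skew : ∀ (p : N) (x y : TBig I p), neutral I p x (𝒥 p y) + neutral I p (𝒥 p x) y = 0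
  sq : ∀ (p : N) (x : TBig I p), 𝒥 p (𝒥 p x) = -x

/-- Integrable generalized almost complex structures, i.e. generalized complex structures. -/
structure IsGenComplex (𝒥 : BigEnd I (N := N)) : Prop extends IsGenAlmostComplex I 𝒥 where
  torsion : ∀ 𝒳 𝒴 : BigField I (N := N), SmoothBigField I 𝒳 → SmoothBigField I 𝒴 →
    ∀ p, courantNijenhuis I 𝒥 𝒳 𝒴 p = 0

/-- A generalized Riemannian metric `G`, encoded by its musical endomorphism `S = ♯_G`, that is,
`G(x, y) = 2 g(S x, y)`; `G` has to be positive definite, and `S` is an involution that preserves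
the neutral metric `g`. -/
structure IsGenMetric (S : BigEnd I (N := N)) : Prop where
  smooth : SmoothBigEnd I S
  invol : ∀ (p : N) (x : TBig I p), S p (S p x) = x
  isometry : ∀ (p : N) (x y : TBig I p), neutral I p (S p x) (S p y) = neutral I p x y
  pos : ∀ (p : N) (x : TBig I p), x ≠ 0 → 0 < 2 * neutral I p (S p x) x

/-- `τ₊⁻¹(X) = (X, ♭_{ψ+γ} X)`, where `♭_b X = b(X, ·)`. -/
def graphPlus (γ ψ : BilinField I (N := N)) (p : N) (v : TangentSpace I p) : TBig I p :=
  (v, ψ p v + γ p v)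

/-- `τ₋⁻¹(X) = (X, ♭_{ψ-γ} X)`. -/
def graphMinus (γ ψ : BilinField I (N := N)) (p : N) (v : TangentSpace I p) : TBig I p :=
  (v, ψ p v - γ p v)

/-- `S` is the musical endomorphism of the generalized Riemannian metric that corresponds to the
pair `(γ, ψ)`: the `±1`-eigenbundles of `S` are the graphs `V_± = {(X, ♭_{ψ±γ} X)}`. -/
structure IsGenMetricOf (γ ψ : BilinField I (N := N)) (S : BigEnd I (N := N)) : Prop
    extends IsGenMetric I S where
  eigen_plus : ∀ (p : N) (v : TangentSpace I p), S p (graphPlus I γ ψ p v) = graphPlus I γ ψ p v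
  eigen_minus : ∀ (p : N) (v : TangentSpace I p),
    S p (graphMinus I γ ψ p v) = -graphMinus I γ ψ p v

/-- Generalized Kähler structures `(G, 𝒥)`, with `S = ♯_G`: `𝒥` is compatible with `G`, and both `𝒥`
and the complementary structure `𝒥ᶜ = ♯_G ∘ 𝒥` are integrable. -/
structure IsGenKahler (S 𝒥 : BigEnd I (N := N)) : Prop where
  metric : IsGenMetric I S
  compatible : ∀ (p : N) (x : TBig I p), S p (𝒥 p x) = 𝒥 p (S p x)
  integrable : IsGenComplex I 𝒥
  integrable_compl : IsGenComplex I (fun p => (S p).comp (𝒥 p))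

/-- `J_+` and `J_-` are the endomorphisms of the tangent bundle that the restrictions of `𝒥` to
`V_+` and `V_-` induce through the projections `τ_± : V_± → TN`. -/
structure IsInducedPair (γ ψ : BilinField I (N := N)) (𝒥 : BigEnd I (N := N))
    (Jp Jm : EndField I (N := N)) : Prop where
  plus : ∀ (p : N) (v : TangentSpace I p),
    𝒥 p (graphPlus I γ ψ p v) = graphPlus I γ ψ p (Jp p v)
  minus : ∀ (p : N) (v : TangentSpace I p),
    𝒥 p (graphMinus I γ ψ p v) = graphMinus I γ ψ p (Jm p v)

end Generalized

/-! ## The manifold `M × ℝ` -/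

section Product

variable {E : Type*} [NormedAddCommGroup E] [NormedSpace ℝ E]
  {H : Type*} [TopologicalSpace H] (I : ModelWithCorners ℝ E H)
  {M : Type*} [TopologicalSpace M] [ChartedSpace H M]

/-- The differential of the projection `M × ℝ → M`. -/
def prM (q : M × ℝ) : TangentSpace (I.prod 𝓘(ℝ, ℝ)) q →L[ℝ] TangentSpace I q.1 :=
  mfderiv (I.prod 𝓘(ℝ, ℝ)) I Prod.fst q

/-- The 1-form `dt` on `M × ℝ`. -/
def dt (q : M × ℝ) : TangentSpace (I.prod 𝓘(ℝ, ℝ)) q →L[ℝ] ℝ :=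
  mfderiv (I.prod 𝓘(ℝ, ℝ)) 𝓘(ℝ, ℝ) Prod.snd q

/-- The differential of the inclusion `M → M × ℝ`, `p ↦ (p, t)`. -/
def inclM (q : M × ℝ) : TangentSpace I q.1 →L[ℝ] TangentSpace (I.prod 𝓘(ℝ, ℝ)) q :=
  mfderiv I (I.prod 𝓘(ℝ, ℝ)) (fun p : M => (p, q.2)) q.1

/-- The vector field `∂/∂t` on `M × ℝ`. -/
def ddt : VField (I.prod 𝓘(ℝ, ℝ)) (N := M × ℝ) := fun q =>
  mfderiv 𝓘(ℝ, ℝ) (I.prod 𝓘(ℝ, ℝ)) (fun t : ℝ => (q.1, t)) q.2 (1 : ℝ)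

/-- `b₁ ⊗ b₂` for two covectors, as a bilinear form. -/
def tens {V : Type*} [AddCommGroup V] [Module ℝ V] [TopologicalSpace V] [IsTopologicalAddGroup V]
    [ContinuousSMul ℝ V] (a b : V →L[ℝ] ℝ) : V →L[ℝ] V →L[ℝ] ℝ :=
  a.smulRight b

/-- The pull-back to `M × ℝ` of a covariant 2-tensor field on `M`. -/
def pullBilin (b : BilinField I (N := M)) : BilinField (I.prod 𝓘(ℝ, ℝ)) (N := M × ℝ) := fun q =>
  let φ : E × ℝ →L[ℝ] E := prM I q
  let c : E →L[ℝ] E →L[ℝ] ℝ := b q.1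
  (c.bilinearComp φ φ : E × ℝ →L[ℝ] E × ℝ →L[ℝ] ℝ)

/-- The metric `Γ = e^t (γ + dt²)` on `M × ℝ`. -/
def coneMetric (γ : BilinField I (N := M)) : BilinField (I.prod 𝓘(ℝ, ℝ)) (N := M × ℝ) := fun q =>
  Real.exp q.2 • (pullBilin I γ q + tens (dt I q) (dt I q))

/-- The 2-form `Ψ = e^t (ψ + κ ∧ dt)` on `M × ℝ`, where `κ ∧ dt = κ ⊗ dt - dt ⊗ κ`. -/
def coneForm (ψ : BilinField I (N := M)) (κ : OneForm I (N := M)) :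
    BilinField (I.prod 𝓘(ℝ, ℝ)) (N := M × ℝ) := fun q =>
  Real.exp q.2 • (pullBilin I ψ q + tens ((κ q.1).comp (prM I q)) (dt I q)
    - tens (dt I q) ((κ q.1).comp (prM I q)))

/-- The almost complex structure `J = F + dt ⊗ Z - ξ ⊗ ∂/∂t` on `M × ℝ`. -/
def adaptedJ (F : EndField I (N := M)) (Z : VField I (N := M)) (ξ : OneForm I (N := M)) :
    EndField (I.prod 𝓘(ℝ, ℝ)) (N := M × ℝ) := fun q =>
  (inclM I q).comp ((F q.1).comp (prM I q)) + (dt I q).smulRight (inclM I q (Z q.1))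
    - ((ξ q.1).comp (prM I q)).smulRight (ddt I q)

/-- Invariance of an endomorphism field of `T(M × ℝ)` by the translations
`(p, t) ↦ (p, t + s)`. -/
def TranslationInvariant (J : EndField (I.prod 𝓘(ℝ, ℝ)) (N := M × ℝ)) : Prop :=
  ∀ (s : ℝ) (q : M × ℝ) (v : TangentSpace (I.prod 𝓘(ℝ, ℝ)) q),
    J (q.1, q.2 + s)
        (mfderiv (I.prod 𝓘(ℝ, ℝ)) (I.prod 𝓘(ℝ, ℝ)) (fun x : M × ℝ => (x.1, x.2 + s)) q v)
      = mfderiv (I.prod 𝓘(ℝ, ℝ)) (I.prod 𝓘(ℝ, ℝ)) (fun x : M × ℝ => (x.1, x.2 + s)) q (J q v)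

end Product

/-! ## Almost contact metric structures, Sasakian and generalized Sasakian structures -/

section Contact

variable {E : Type*} [NormedAddCommGroup E] [NormedSpace ℝ E]
  {H : Type*} [TopologicalSpace H] (I : ModelWithCorners ℝ E H)
  {M : Type*} [TopologicalSpace M] [ChartedSpace H M] [IsManifold I ∞ M]

/-- Almost contact metric structures `(F, Z, ξ, γ)` on the Riemannian manifold `(M, γ)`. -/
structure AlmostContactMetric
    (γ : Bundle.ContMDiffRiemannianMetric I ∞ E (fun p : M => TangentSpace I p)) where
  F : EndField I (N := M)
  Z : VField I (N := M)
  ξ : OneForm I (N := M)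
  smooth_F : SmoothEndField I F
  smooth_Z : SmoothVField I Z
  smooth_ξ : SmoothOneForm I ξ
  F_sq : ∀ (p : M) (v : TangentSpace I p), F p (F p v) = -v + ξ p v • Z p
  ξ_F : ∀ (p : M) (v : TangentSpace I p), ξ p (F p v) = 0
  F_Z : ∀ p : M, F p (Z p) = 0
  ξ_Z : ∀ p : M, ξ p (Z p) = 1
  metric : ∀ (p : M) (v w : TangentSpace I p),
    γ.inner p (F p v) (F p w) = γ.inner p v w - ξ p v * ξ p w

namespace AlmostContactMetric

variable {I}
variable {γ : Bundle.ContMDiffRiemannianMetric I ∞ E (fun p : M => TangentSpace I p)}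

/-- The associated almost complex structure of `M × ℝ`. -/
def J (A : AlmostContactMetric I γ) : EndField (I.prod 𝓘(ℝ, ℝ)) (N := M × ℝ) :=
  adaptedJ I A.F A.Z A.ξ

/-- The fundamental 2-form `Ξ(X, Y) = γ(F X, Y)`. -/
def fundForm (A : AlmostContactMetric I γ) : BilinField I (N := M) := fun p =>
  (γ.inner p).comp (A.F p)

/-- Normality: the associated almost complex structure of `M × ℝ` is integrable. -/
def IsNormal (A : AlmostContactMetric I γ) : Prop :=
  NijenhuisVanishes (I.prod 𝓘(ℝ, ℝ)) A.J

/-- Vanishing of the derived fundamental form `L_Z Ξ`. -/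
def DerivedFormVanishes (A : AlmostContactMetric I γ) : Prop :=
  LieBilinVanishes I A.Z A.fundForm

/-- `L_Z γ = 0`. -/
def LieMetricVanishes (A : AlmostContactMetric I γ) : Prop :=
  LieBilinVanishes I A.Z γ.inner

/-- Sasakian structures: normal, with `Ξ = dξ`. -/
structure IsSasakian (A : AlmostContactMetric I γ) : Prop where
  normal : A.IsNormal
  contact : A.fundForm = extDerivOne I A.ξ

end AlmostContactMetric

/-- A generalized Sasakian structure on `M`: a generalized Riemannian metric `G` on `M`, which
corresponds to `(γ, ψ)` and has the musical endomorphism `S = ♯_G`, and an endomorphism field `𝒥` of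
the big tangent bundle of `M × ℝ`, such that, for the 1-form `κ` and the generalized Riemannian metric
`G̃` (with musical endomorphism `St`) of `M × ℝ` that corresponds to
`(e^t (γ + dt²), e^t (ψ + κ ∧ dt))`, the pair `(G̃, 𝒥)` is a generalized Kähler structure whose
induced pair `(J_+, J_-)` is translation invariant. -/
structure IsGenSasakian
    (γ : Bundle.ContMDiffRiemannianMetric I ∞ E (fun p : M => TangentSpace I p))
    (ψ : BilinField I (N := M)) (κ : OneForm I (N := M)) (S : BigEnd I (N := M))
    (St 𝒥 : BigEnd (I.prod 𝓘(ℝ, ℝ)) (N := M × ℝ))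
    (Jp Jm : EndField (I.prod 𝓘(ℝ, ℝ)) (N := M × ℝ)) : Prop where
  form : IsTwoForm I ψ
  smooth_κ : SmoothOneForm I κ
  metric : IsGenMetricOf I γ.inner ψ S
  cone : IsGenMetricOf (I.prod 𝓘(ℝ, ℝ)) (coneMetric I γ.inner) (coneForm I ψ κ) St
  kahler : IsGenKahler (I.prod 𝓘(ℝ, ℝ)) St 𝒥
  induced : IsInducedPair (I.prod 𝓘(ℝ, ℝ)) (coneMetric I γ.inner) (coneForm I ψ κ) 𝒥 Jp Jm
  invariant_plus : TranslationInvariant I Jp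
  invariant_minus : TranslationInvariant I Jm

/-- A pair of almost contact metric structures with the same metric `γ` corresponds to a generalized
Sasakian structure if there is a generalized Sasakian structure with metric part `γ` whose induced
almost complex structures `J_±` on `M × ℝ` are those associated with the two structures. -/
def CorrespondsToGenSasakian
    {γ : Bundle.ContMDiffRiemannianMetric I ∞ E (fun p : M => TangentSpace I p)}
    (Ap Am : AlmostContactMetric I γ) : Prop :=
  ∃ (ψ : BilinField I (N := M)) (κ : OneForm I (N := M)) (S : BigEnd I (N := M))
    (St 𝒥 : BigEnd (I.prod 𝓘(ℝ, ℝ)) (N := M × ℝ)),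
    IsGenSasakian I γ ψ κ S St 𝒥 Ap.J Am.J

end Contact

end GenSasaki

end

/-! First equivalence. Normality, tested on `∂/∂t` and a field of `M`, gives `L_Z F = 0` and `L_Z ξ
= 0` (`IsNormal.lie_Z`). Hence `L_Z Ξ = (L_Z γ)(F ·, ·)`. Conversely `Ξ(X, FY) = γ(X, Y) - ξ(X)
ξ(Y)` recovers `L_Z γ` from `L_Z Ξ`.

From Sasakian to generalized Sasakian. The form `ω = Γ(J ·, ·)` of the cone metric `Γ = e^t (γ +
dt²)` is `e^t (Ξ + dt ∧ ξ)`, which equals `d(e^t ξ)` when `Ξ = dξ`. So both `J_±` are Kähler for the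
same `Γ`, and `ψ = 0`, `κ = 0` work. Two Kähler structures `J`, `K` with one metric always give a
generalized Kähler structure, acting as `J` on `V_+` and as `K` on `V_-`: the Courant bracket can be
written with the Levi-Civita connection, for which `J` and `K` are parallel, so its torsion reduces
to the Nijenhuis tensors (`courantPlus_torsion`).

From generalized Sasakian to Sasakian. Integrability of `𝒥` and `♯_G ∘ 𝒥` forces `dω_± ± J_± · dΨ =
0`, where `J · dΨ` inserts `J` in each argument in turn and adds (`IsGenKahler.dTwo_fundamental`).
On the cone, `dω = e^t (dΞ + dt ∧ β)` and `dΨ = e^t (dψ + dt ∧ σ)` with `β = Ξ - dξ` and `σ = ψ +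
dκ`. Evaluation on `∂/∂t` and on `Z`, together with `i_Z dΞ = 0` (from `L_Z Ξ = 0`), leaves
algebraic relations between `β`, `σ` and `τ = i_Z dψ`. They force `σ = 0`
(`eq_zero_of_contact_relations`). Then `ψ = -dκ` is closed, `τ = 0` and `β = 0`, which is the
Sasakian condition.

The identities are proved for a Lie ring acting on a commutative ring, with biadditive forms: only
brackets and the action enter, and no connection is constructed, since `koszul` stands for `2 g(∇_X
Y, W)`. Smooth vector fields acting on smooth functions form such a pair, and pointwise statements
follow because every tangent vector extends to a global smooth field. -/

noncomputable section

namespace GenSasaki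

/-! ## Cartan and Koszul calculus over a Lie ring acting on a commutative ring -/

section Koszul

variable {V C : Type*} [LieRing V] [CommRing C] [LieRingModule V C]

/-- The exterior derivative of a 1-form in terms of Lie brackets. -/
def dOne (α : V →+ C) (X Y : V) : C := ⁅X, α Y⁆ - ⁅Y, α X⁆ - α ⁅X, Y⁆

/-- The exterior derivative of a 2-form in terms of Lie brackets. -/
def dTwo (b : V →+ V →+ C) (X Y W : V) : C :=
  ⁅X, b Y W⁆ + ⁅Y, b W X⁆ + ⁅W, b X Y⁆ - b ⁅X, Y⁆ W - b ⁅Y, W⁆ X - b ⁅W, X⁆ Y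

/-- The Koszul expression `2 g(∇_X Y, W)` of the Levi-Civita connection. -/
def koszul (g : V →+ V →+ C) (X Y W : V) : C :=
  ⁅X, g Y W⁆ + ⁅Y, g X W⁆ - ⁅W, g X Y⁆ + g ⁅X, Y⁆ W - g ⁅X, W⁆ Y - g ⁅Y, W⁆ X

theorem koszul_neg_middle (g : V →+ V →+ C) (X Y W : V) :
    koszul g X (-Y) W = -koszul g X Y W := by
  simp only [koszul, neg_lie, lie_neg, map_neg, AddMonoidHom.neg_apply]
  ring

theorem koszul_neg_right (g : V →+ V →+ C) (X Y W : V) :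
    koszul g X Y (-W) = -koszul g X Y W := by
  simp only [koszul, neg_lie, lie_neg, map_neg, AddMonoidHom.neg_apply]
  ring

theorem dTwo_neg_middle (b : V →+ V →+ C) (X Y W : V) : dTwo b X (-Y) W = -dTwo b X Y W := by
  simp only [dTwo, neg_lie, lie_neg, map_neg, AddMonoidHom.neg_apply]
  ring

/-- `d² = 0` on 1-forms. -/
theorem dTwo_eq_zero_of_eq_dOne (α : V →+ C) (b : V →+ V →+ C)
    (h : ∀ X Y, b X Y = dOne α X Y) (X Y W : V) : dTwo b X Y W = 0 := by
  have e1 := congrArg α (lie_jacobi X Y W)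
  simp only [map_add, map_zero] at e1
  have k1 := lie_lie X Y (α W)
  have k2 := lie_lie Y W (α X)
  have k3 := lie_lie W X (α Y)
  have s1 : α ⁅⁅X, Y⁆, W⁆ = -α ⁅W, ⁅X, Y⁆⁆ := by rw [← map_neg, lie_skew]
  have s2 : α ⁅⁅Y, W⁆, X⁆ = -α ⁅X, ⁅Y, W⁆⁆ := by rw [← map_neg, lie_skew]
  have s3 : α ⁅⁅W, X⁆, Y⁆ = -α ⁅Y, ⁅W, X⁆⁆ := by rw [← map_neg, lie_skew]
  simp only [dTwo, h, dOne, lie_sub, k1, k2, k3, s1, s2, s3]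
  linear_combination -e1

/-- The connection is metric: `X(g(Y, W)) = g(∇_X Y, W) + g(Y, ∇_X W)`, doubled. -/
theorem koszul_add_koszul_swap (g : V →+ V →+ C) (hg : ∀ X Y, g X Y = g Y X) (X Y W : V) :
    koszul g X Y W + koszul g X W Y = 2 * ⁅X, g Y W⁆ := by
  have s : g ⁅W, Y⁆ X = -g ⁅Y, W⁆ X := by rw [← lie_skew, map_neg, AddMonoidHom.neg_apply]
  simp only [koszul, hg W Y, s]
  ring

/-- The connection has no torsion: `∇_X Y - ∇_Y X = [X, Y]`, paired with `W` and doubled. -/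
theorem koszul_sub_koszul_swap (g : V →+ V →+ C) (hg : ∀ X Y, g X Y = g Y X) (X Y W : V) :
    koszul g X Y W - koszul g Y X W = 2 * g ⁅X, Y⁆ W := by
  have s : g ⁅Y, X⁆ W = -g ⁅X, Y⁆ W := by rw [← lie_skew, map_neg, AddMonoidHom.neg_apply]
  simp only [koszul, hg Y X, s]
  ring

/-- For a torsion-free metric connection, `dω` is the cyclic sum of `g((∇_X J) Y, W)`. Each
bracketed pair of `koszul` terms is twice such a summand. -/
theorem two_mul_dTwo_comp (g : V →+ V →+ C) (J : V →+ V) (hg : ∀ X Y, g X Y = g Y X)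
    (hJ : ∀ X Y, g (J X) Y = -g X (J Y)) (X Y W : V) :
    koszul g X (J Y) W + koszul g X Y (J W) + (koszul g Y (J W) X + koszul g Y W (J X))
      + (koszul g W (J X) Y + koszul g W X (J Y)) = 2 * dTwo (g.comp J) X Y W := by
  have s (A B D : V) : g ⁅A, J B⁆ D = -g ⁅J B, A⁆ D := by
    rw [← lie_skew, map_neg, AddMonoidHom.neg_apply]
  have t (A B : V) : g A (J B) = -g B (J A) := by rw [hg, hJ]
  have e1 : g ⁅Y, X⁆ = -g ⁅X, Y⁆ := by rw [← lie_skew, map_neg]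
  have e2 : g ⁅W, Y⁆ = -g ⁅Y, W⁆ := by rw [← lie_skew, map_neg]
  have e3 : g ⁅X, W⁆ = -g ⁅W, X⁆ := by rw [← lie_skew, map_neg]
  simp only [koszul, dTwo, AddMonoidHom.comp_apply, hJ, s _ X, s _ Y, s _ W, e1, e2, e3,
    AddMonoidHom.neg_apply, t W Y, t Y X, t X W, lie_neg, hg W X, hg Y X, hg W Y]
  ring

end Koszul

/-! ### Kähler structures and parallelism of the complex structure -/

section Kahler

variable {V C : Type*} [LieRing V] [CommRing C] [LieRingModule V C]

/-- Almost complex structures that are Hermitian with respect to `g`, integrable, and with closed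
fundamental form. -/
structure IsKahlerPair (g : V →+ V →+ C) (J : V →+ V) : Prop where
  sq : ∀ X, J (J X) = -X
  skew : ∀ X Y, g (J X) Y = -g X (J Y)
  integrable : ∀ X Y, ⁅J X, J Y⁆ - J ⁅X, J Y⁆ - J ⁅J X, Y⁆ + J (J ⁅X, Y⁆) = 0
  closed : ∀ X Y W, dTwo (g.comp J) X Y W = 0

/-- `V_-` for `g` is `V_+` for `-g`; definiteness plays no role here, so results on `V_+` transfer
to `V_-`. -/
theorem IsKahlerPair.neg {g : V →+ V →+ C} {J : V →+ V} (h : IsKahlerPair g J) :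
    IsKahlerPair (-g) J where
  sq := h.sq
  skew X Y := by simp only [AddMonoidHom.neg_apply, h.skew]
  integrable := h.integrable
  closed X Y W := by
    have := h.closed X Y W
    simp only [dTwo, AddMonoidHom.comp_apply, AddMonoidHom.neg_apply, lie_neg] at this ⊢
    linear_combination -this

/-- The complementary structure `♯_G ∘ 𝒥` acts on `V_-` by the opposite complex structure. -/
theorem IsKahlerPair.neg_right {g : V →+ V →+ C} {J : V →+ V} (h : IsKahlerPair g J) :
    IsKahlerPair g (-J) where
  sq X := by simp only [AddMonoidHom.neg_apply, map_neg, h.sq, neg_neg]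
  skew X Y := by simp only [AddMonoidHom.neg_apply, map_neg, h.skew]
  integrable X Y := by
    simp only [AddMonoidHom.neg_apply, map_neg, neg_lie, lie_neg, neg_neg]
    rw [← h.integrable X Y]
  closed X Y W := by
    have := h.closed X Y W
    simp only [dTwo, AddMonoidHom.comp_apply, AddMonoidHom.neg_apply, map_neg, lie_neg] at this ⊢
    linear_combination -this

/-- On a Kähler manifold the complex structure is parallel. -/
theorem IsKahlerPair.koszul_apply {g : V →+ V →+ C} {J : V →+ V} (h : IsKahlerPair g J)
    (hg : ∀ X Y, g X Y = g Y X) (htwo : ∀ c : C, 2 * c = 0 → c = 0) (X Y W : V) :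
    koszul g X (J Y) W + koszul g X Y (J W) = 0 := by
  -- Write `A(X, Y, W) = 2 g((∇_X J) Y, W)` for the expression to be killed. It is skew in `Y`, `W`,
  -- because `J` is skew and the connection is metric.
  have skew (X Y W : V) : koszul g X (J Y) W + koszul g X Y (J W)
      + (koszul g X (J W) Y + koszul g X W (J Y)) = 0 := by
    have e := h.skew Y W
    have e' : ⁅X, g (J Y) W⁆ = -⁅X, g Y (J W)⁆ := by rw [e, lie_neg]
    linear_combination koszul_add_koszul_swap g hg X (J Y) W
      + koszul_add_koszul_swap g hg X Y (J W) + 2 * e'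
  -- The Nijenhuis tensor in terms of `A`: `A(JX, Y, W) - A(JY, X, W) - A(Y, X, JW) + A(X, Y, JW) =
  -- 0`.
  have hN (X Y W : V) : koszul g (J X) (J Y) W + koszul g (J X) Y (J W)
      - (koszul g (J Y) (J X) W + koszul g (J Y) X (J W))
      - (koszul g Y (J X) (J W) - koszul g Y X W)
      + (koszul g X (J Y) (J W) - koszul g X Y W) = 0 := by
    have e := congrArg (fun v => 2 * g v W) (h.integrable X Y)
    simp only [map_add, map_sub, AddMonoidHom.add_apply, AddMonoidHom.sub_apply, h.skew, h.sq,
      map_neg, map_zero, AddMonoidHom.zero_apply, AddMonoidHom.neg_apply] at e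
    linear_combination e + koszul_sub_koszul_swap g hg (J X) (J Y) W
      + koszul_sub_koszul_swap g hg X (J Y) (J W) + koszul_sub_koszul_swap g hg (J X) Y (J W)
      - koszul_sub_koszul_swap g hg X Y W
  have hd (X Y W : V) : koszul g X (J Y) W + koszul g X Y (J W)
      + (koszul g Y (J W) X + koszul g Y W (J X)) + (koszul g W (J X) Y + koszul g W X (J Y)) = 0 := by
    rw [two_mul_dTwo_comp g J hg h.skew, h.closed, mul_zero]
  have n1 := hN Y W (J X)
  have d1 := hd X Y W
  have d2 := hd X (J Y) (J W)
  have s1 := skew (J W) (J Y) X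
  have s2 := skew W Y X
  simp only [h.sq, koszul_neg_middle, koszul_neg_right] at n1 d1 d2 s1 s2
  refine htwo _ ?_
  -- The classical formula for `2 A(X, Y, W)` as `dω(X, Y, W) - dω(X, JY, JW)` plus a Nijenhuis
  -- term, up to constants.
  linear_combination d1 - d2 + n1 + s1 - s2

end Kahler

/-! ### The Courant bracket through the Levi-Civita connection -/

section Courant

variable {V C : Type*} [LieRing V] [CommRing C] [LieRingModule V C]

/-- Twice the form component of the Courant bracket of `(X, α)` and `(Y, β)`. -/
def courantTwo (α β : V →+ C) (X Y W : V) : C :=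
  2 * (⁅X, β W⁆ - β ⁅X, W⁆) - 2 * (⁅Y, α W⁆ - α ⁅Y, W⁆) + ⁅W, α Y - β X⁆

/-- The bracket of two sections of the graph of `ψ + g` lies in this graph up to a defect. The
2-form contributes `dψ(X, Y, W)`, and the metric contributes `g(∇_W X, Y) - g(∇_W Y, X)`. -/
theorem courantTwo_graph (ψ g : V →+ V →+ C) (hψ : ∀ X Y, ψ X Y = -ψ Y X)
    (hg : ∀ X Y, g X Y = g Y X) (X Y W : V) :
    courantTwo (ψ X + g X) (ψ Y + g Y) X Y W =
      2 * (ψ ⁅X, Y⁆ W + g ⁅X, Y⁆ W) + 2 * dTwo ψ X Y W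
        + (koszul g W X Y - koszul g W Y X) := by
  have e1 : ψ X ⁅Y, W⁆ = -ψ ⁅Y, W⁆ X := hψ _ _
  have e2 : ψ Y ⁅X, W⁆ = ψ ⁅W, X⁆ Y := by
    rw [hψ, ← lie_skew, map_neg, AddMonoidHom.neg_apply, neg_neg]
  have e3 : g ⁅W, X⁆ Y = - g ⁅X, W⁆ Y := by rw [← lie_skew, map_neg, AddMonoidHom.neg_apply]
  have e4 : g ⁅W, Y⁆ X = - g ⁅Y, W⁆ X := by rw [← lie_skew, map_neg, AddMonoidHom.neg_apply]
  have e5 : g ⁅Y, X⁆ W = - g ⁅X, Y⁆ W := by rw [← lie_skew, map_neg, AddMonoidHom.neg_apply]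
  simp only [courantTwo, dTwo, koszul, AddMonoidHom.add_apply, lie_add, lie_sub, e1, e2, e3, e4, e5,
    hg X ⁅Y, W⁆, hg Y ⁅X, W⁆, hg Y X, hg W X, hg W Y, hψ Y X, hψ W X, lie_neg]
  ring

/-- The condition that `V_+` of a generalized Kähler structure imposes: `dω = -J · dψ`. -/
theorem dTwo_fundamental_of_courant (ψ g : V →+ V →+ C) (J : V →+ V)
    (hψ : ∀ X Y, ψ X Y = -ψ Y X) (hg : ∀ X Y, g X Y = g Y X) (htwo : ∀ c : C, 2 * c = 0 → c = 0)
    (sq : ∀ X, J (J X) = -X) (skew : ∀ X Y, g (J X) Y = -g X (J Y))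
    (H : ∀ X Y W, courantTwo (ψ (J X) + g (J X)) (ψ (J Y) + g (J Y)) (J X) (J Y) W
        - courantTwo (ψ X + g X) (ψ Y + g Y) X Y W
      = 2 * (ψ (⁅J X, J Y⁆ - ⁅X, Y⁆) W + g (⁅J X, J Y⁆ - ⁅X, Y⁆) W)) (X Y W : V) :
    dTwo (g.comp J) X Y W + (dTwo ψ (J X) Y W + dTwo ψ X (J Y) W + dTwo ψ X Y (J W)) = 0 := by
  have key (X Y W : V) : dTwo ψ (J X) Y W + dTwo ψ X (J Y) W
      + (koszul g W (J X) Y + koszul g W X (J Y)) = 0 := by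
    -- With `JY` in place of `Y`, the two metric defects combine into `2 g((∇_W J) X, Y)`. The
    -- cyclic sum of the resulting identity is then twice the claim, by `two_mul_dTwo_comp`.
    have e := H X (J Y) W
    rw [courantTwo_graph ψ g hψ hg, courantTwo_graph ψ g hψ hg] at e
    simp only [sq, koszul_neg_middle, koszul_neg_right, dTwo_neg_middle, map_sub,
      AddMonoidHom.sub_apply] at e
    have k1 := koszul_add_koszul_swap g hg W (J X) Y
    have k2 := koszul_add_koszul_swap g hg W X (J Y)
    have k3 : ⁅W, g (J X) Y⁆ = -⁅W, g X (J Y)⁆ := by rw [skew, lie_neg]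
    refine htwo _ ?_
    linear_combination -e + k1 + k2 + 2 * k3
  have c (X Y W : V) : dTwo ψ X Y W = dTwo ψ Y W X := by simp only [dTwo]; ring
  refine htwo _ ?_
  have t := two_mul_dTwo_comp g J hg skew X Y W
  linear_combination key X Y W + key Y W X + key W X Y - t + c X (J Y) W + c X Y (J W)
    - c (J W) X Y - c W (J X) Y

/-- Twice the value on `W` of the projection to `V_+` of the Courant bracket of the sections with
projections `X, Y` to `V_+` and `X', Y'` to `V_-`. -/
def courantPlus (g : V →+ V →+ C) (X X' Y Y' W : V) : C :=
  4 * g ⁅X, Y⁆ W + (koszul g W X Y - koszul g W Y X) + 2 * koszul g X' Y W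
    - 2 * koszul g Y' X W - (koszul g W X' Y' - koszul g W Y' X')

/-- The section with components `X`, `X'` is `(X + X', g(X - X'))`, and its `V_+` component is half
the sum of the vector part and the sharp of the form part. -/
theorem courantPlus_eq (g : V →+ V →+ C) (hg : ∀ X Y, g X Y = g Y X) (X X' Y Y' W : V) :
    2 * g ⁅X + X', Y + Y'⁆ W + courantTwo (g X - g X') (g Y - g Y') (X + X') (Y + Y') W
      = courantPlus g X X' Y Y' W := by
  have s (A B D : V) : g ⁅A, B⁆ D = -g ⁅B, A⁆ D := by
    rw [← lie_skew, map_neg, AddMonoidHom.neg_apply]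
  simp only [courantPlus, courantTwo, koszul, lie_add, add_lie, lie_sub, map_add,
    AddMonoidHom.add_apply, AddMonoidHom.sub_apply, s W X, s W Y, s W X', s W Y', s Y' X,
    s Y X, s Y' X', hg _ ⁅_, _⁆,
    hg Y X, hg Y' X, hg Y X', hg Y' X', hg W X, hg W Y, hg W X', hg W Y']
  ring

/-- In `courantPlus` everything except `4 g([X, Y], W)` consists of covariant derivatives. As `J`
and `K` are parallel, `J` and `K` move across these terms and they cancel, leaving `4 g(N_J(X, Y),
W) = 0`. -/
theorem courantPlus_torsion (g : V →+ V →+ C) (hg : ∀ X Y, g X Y = g Y X)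
    (htwo : ∀ c : C, 2 * c = 0 → c = 0) {J K : V →+ V}
    (hJ : IsKahlerPair g J) (hK : IsKahlerPair g K) (X X' Y Y' W : V) :
    courantPlus g (J X) (K X') (J Y) (K Y') W + courantPlus g X X' (J Y) (K Y') (J W)
      + courantPlus g (J X) (K X') Y Y' (J W) - courantPlus g X X' Y Y' W = 0 := by
  have j (A B D : V) : koszul g A B (J D) = -koszul g A (J B) D := by
    linear_combination hJ.koszul_apply hg htwo A B D
  have k (A B D : V) : koszul g A B (K D) = -koszul g A (K B) D := by
    linear_combination hK.koszul_apply hg htwo A B D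
  have e := congrArg (fun v => 4 * g v W) (hJ.integrable X Y)
  simp only [map_add, map_sub, AddMonoidHom.add_apply, AddMonoidHom.sub_apply, hJ.skew, hJ.sq,
    map_neg, map_zero, AddMonoidHom.zero_apply, AddMonoidHom.neg_apply] at e
  simp only [courantPlus, j, k, hJ.sq, hK.sq, koszul_neg_middle]
  linear_combination e

end Courant

/-! ### Algebra of the contact relations on the cone -/

section Contact

variable {V C : Type*} [AddCommGroup V] [CommRing C]

/-- First `i_Z σ = 0`, so that `F²` acts as `-1` in each slot of `σ`. Since `β` is `F`-invariant,
eliminating `τ` between the two relations gives `σ(Y, W) = 2 σ(FY, FW)`. Applying this twice yields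
`σ = 4 σ`. -/
theorem eq_zero_of_contact_relations {F : V →+ V} {Z : V} {ξ : V → C} {σ τ β : V →+ V →+ C} {c : C}
    (hF : F Z = 0) (hσF : ∀ Y W, σ (F (F Y)) W = -σ Y W + ξ Y * σ Z W)
    (hσ : ∀ Y W, σ Y W = -σ W Y) (hβF : ∀ Y W, β (F Y) W + β Y (F W) = 0)
    (hβ : ∀ W, β Z W = 0) (hτ : ∀ W, τ Z W = 0) (hσZ : σ Z Z = 0)
    (h₁ : ∀ Y W, β Y W = c * (τ Y W + σ (F Y) W + σ Y (F W))) (hc : c * c = 1)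
    (h₂ : ∀ Y W, σ Y W = τ (F Y) W + τ Y (F W) + ξ Y * σ Z W - ξ W * σ Z Y)
    (hthree : ∀ x : C, 3 * x = 0 → x = 0) (Y W : V) : σ Y W = 0 := by
  -- The first relation at `Y = Z`, where `β`, `τ` and `F` all vanish.
  have hZF (W : V) : σ Z (F W) = 0 := by
    have e := h₁ Z W
    simp only [hβ, hτ, hF, map_zero, AddMonoidHom.zero_apply, zero_add] at e
    linear_combination -c * e - σ Z (F W) * hc
  have hZ (W : V) : σ Z W = 0 := by
    have e := hσF W Z
    have e' := hσ (F (F W)) Z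
    rw [hZF] at e'
    rw [hσZ] at e
    linear_combination -e + e' + hσ Z W
  have hFF (Y W : V) : σ (F (F Y)) W = -σ Y W := by rw [hσF, hZ, mul_zero, add_zero]
  have hFF' (Y W : V) : σ Y (F (F W)) = -σ Y W := by rw [hσ, hFF, ← hσ]
  -- Adding the first relation at `(FY, W)` and at `(Y, FW)` kills the `β` side. The `τ` terms are
  -- `σ(Y, W)` by the second relation.
  have key (Y W : V) : σ Y W = 2 * σ (F Y) (F W) := by
    have e₁ := h₁ (F Y) W
    have e₂ := h₁ Y (F W)
    have e₃ := h₂ Y W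
    rw [hFF] at e₁
    rw [hFF'] at e₂
    rw [hZ, hZ] at e₃
    linear_combination -e₃ + c * (e₁ + e₂) - c * hβF Y W
      + (τ (F Y) W + τ Y (F W) - 2 * σ Y W + 2 * σ (F Y) (F W)) * hc
  have k := key (F Y) (F W)
  rw [hFF, hFF'] at k
  exact hthree _ (by linear_combination -key Y W - 2 * k)

end Contact
end GenSasaki
end

/-! ### The exterior derivative and the Lie bracket in the preferred chart -/

noncomputable section
namespace GenSasaki

open Bundle Set
open scoped Topology

set_option linter.unusedSectionVars false
section
variable {E : Type*} [NormedAddCommGroup E] [NormedSpace ℝ E] 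
  {H : Type*} [TopologicalSpace H] {I : ModelWithCorners ℝ E H}
  {N : Type*} [TopologicalSpace N] [ChartedSpace H N] 

/-- The vector field `V` read in the preferred chart at `p`. -/
def vFieldInChart (V : VField I (N := N)) (p : N) (y : E) : E :=
  VectorField.mpullbackWithin 𝓘(ℝ, E) I (extChartAt I p).symm V (range I) y

variable (I) in
/-- The differential of the inverse of the preferred chart at `p`. -/
def chartSymmDeriv (p : N) (y : E) : E →L[ℝ] TangentSpace I ((extChartAt I p).symm y) :=
  mfderivWithin 𝓘(ℝ, E) I (extChartAt I p).symm (range I) y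

theorem oneFormInChart_apply (α : OneForm I (N := N)) (p : N) (y v : E) :
    oneFormInChart I α p y v = α _ (chartSymmDeriv I p y v) := rfl

variable [IsManifold I ∞ N]

theorem chartSymmDeriv_vFieldInChart (V : VField I (N := N)) {p : N} {y : E}
    (hy : y ∈ (extChartAt I p).target) :
    chartSymmDeriv I p y (vFieldInChart V p y) = V ((extChartAt I p).symm y) := by
  have h := isInvertible_mfderivWithin_extChartAt_symm (I := I) hy
  exact h.self_apply_inverse _

theorem vFieldInChart_self (V : VField I (N := N)) (p : N) :
    vFieldInChart V p (extChartAt I p p) = (V p : E) := by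
  have h := mfderivWithin_extChartAt_symm_inverse_apply (I := I) (V p)
  have e : ∀ q, q = p → (V q : E) = (V p : E) := by rintro q rfl; rfl
  exact (congrArg (mfderivWithin 𝓘(ℝ, E) I (extChartAt I p).symm (range I)
    (extChartAt I p p)).inverse (e _ (extChartAt_to_inv p))).trans h

theorem oneFormInChart_self (α : OneForm I (N := N)) (p : N) (v : E) :
    oneFormInChart I α p (extChartAt I p p) v = α p v := by
  have e : ∀ q, q = p → ∀ w : E, α q w = α p w := by rintro q rfl w; rfl
  have e' : (chartSymmDeriv I p (extChartAt I p p) v : E) = v :=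
    congrArg (fun L : E →L[ℝ] TangentSpace I p => (L v : E)) mfderivWithin_range_extChartAt_symm
  exact (congrArg (fun w : E => α _ w) e').trans (e _ (extChartAt_to_inv p) v)

theorem mfderiv_extChartAt_self_apply (p : N) (v : TangentSpace I p) :
    (mfderiv I 𝓘(ℝ, E) (extChartAt I p) p v : E) = (v : E) :=
  congrArg (fun L : TangentSpace I p →L[ℝ] TangentSpace I p => L v) mfderiv_extChartAt_self

variable [I.Boundaryless]

theorem differentiableAt_vFieldInChart [CompleteSpace E] {V : VField I (N := N)}
    (hV : SmoothVField I V) (p : N) :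
    DifferentiableAt ℝ (vFieldInChart V p) (extChartAt I p p) := by
  have h : DifferentiableWithinAt ℝ (vFieldInChart V p) (univ ∩ range I) (extChartAt I p p) :=
    ((hV.mdifferentiable (by simp) p).mdifferentiableWithinAt
      (s := univ)).differentiableWithinAt_mpullbackWithin_vectorField
  rwa [I.range_eq_univ, univ_inter, differentiableWithinAt_univ] at h

/-- The preferred chart at `p` has the identity as its differential at `p`, so the pull-backs in the
definition of the bracket disappear at `p` itself. -/
theorem mlieBracket_eq_inChart (V W : VField I (N := N)) (p : N) :
    VectorField.mlieBracket I V W p =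
      (fderiv ℝ (vFieldInChart W p) (extChartAt I p p) (V p : E)
      - fderiv ℝ (vFieldInChart V p) (extChartAt I p p) (W p : E) : E) := by
  have h : ∀ v : E, ((mfderiv I 𝓘(ℝ, E) (extChartAt I p) p).inverse v : E) = v := fun v =>
    ((isInvertible_mfderiv_extChartAt (mem_extChartAt_source (I := I) p)).inverse_apply_eq).2
      (mfderiv_extChartAt_self_apply p (v : E)).symm
  refine (h _).trans ?_
  rw [← vFieldInChart_self V, ← vFieldInChart_self W]
  change VectorField.lieBracketWithin ℝ (vFieldInChart V p) (vFieldInChart W p)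
    (univ ∩ range I) (extChartAt I p p) = _
  rw [I.range_eq_univ, univ_inter, VectorField.lieBracketWithin_univ, VectorField.lieBracket_eq]

theorem eventually_mem_extChartAt_target (p : N) :
    ∀ᶠ y in 𝓝 (extChartAt I p p), y ∈ (extChartAt I p).target := extChartAt_target_mem_nhds p

theorem contDiffAt_comp_extChartAt_symm {F : Type*} [NormedAddCommGroup F] [NormedSpace ℝ F]
    {f : N → F} {p : N} (hf : ContMDiffAt I 𝓘(ℝ, F) ∞ f p) :
    ContDiffAt ℝ ∞ (f ∘ (extChartAt I p).symm) (extChartAt I p p) := by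
  have h := (contMDiffWithinAt_extChartAt_symm_range (I := I) (n := ∞) p
    (mem_extChartAt_target p))
  rw [I.range_eq_univ, contMDiffWithinAt_univ] at h
  rw [← extChartAt_to_inv (I := I) p] at hf
  exact (hf.comp _ h).contDiffAt

theorem mfderiv_eq_fderiv_inChart {F : Type*} [NormedAddCommGroup F] [NormedSpace ℝ F]
    {f : N → F} {p : N} (hf : MDifferentiableAt I 𝓘(ℝ, F) f p) (v : TangentSpace I p) :
    (mfderiv I 𝓘(ℝ, F) f p v : F)
      = fderiv ℝ (f ∘ (extChartAt I p).symm) (extChartAt I p p) (v : E) := by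
  have e : mfderiv I 𝓘(ℝ, F) f p = fderivWithin ℝ (f ∘ (extChartAt I p).symm) (range I) (extChartAt I p p) := by
    unfold mfderiv
    exact if_pos hf
  rw [I.range_eq_univ, fderivWithin_univ] at e
  exact congrArg (fun L : E →L[ℝ] F => L (v : E)) e

theorem extDerivOne_apply_inChart (α : OneForm I (N := N)) (p : N) (v w : TangentSpace I p) :
    extDerivOne I α p v w = fderiv ℝ (oneFormInChart I α p) (extChartAt I p p) (v : E) (w : E)
      - fderiv ℝ (oneFormInChart I α p) (extChartAt I p p) (w : E) (v : E) := by
  have e : fderivWithin ℝ (oneFormInChart I α p) (range I) (extChartAt I p p) =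
    fderiv ℝ (oneFormInChart I α p) (extChartAt I p p) := by rw [I.range_eq_univ, fderivWithin_univ]
  rw [← e]
  have hv := mfderiv_extChartAt_self_apply p v
  have hw := mfderiv_extChartAt_self_apply p w
  exact congrArg₂ (fun v w : E => fderivWithin ℝ (oneFormInChart I α p) (range I) (extChartAt I p p) v w -
    fderivWithin ℝ (oneFormInChart I α p) (range I) (extChartAt I p p) w v) hv hw

/-- The exterior derivative of a 1-form on vector fields. -/
theorem extDerivOne_apply_eq [CompleteSpace E] {α : OneForm I (N := N)} {V W : VField I (N := N)} {p : N}
    (hα : DifferentiableAt ℝ (oneFormInChart I α p) (extChartAt I p p))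
    (hV : SmoothVField I V) (hW : SmoothVField I W)
    (hαV : MDifferentiableAt I 𝓘(ℝ, ℝ) (fun q => α q (V q)) p)
    (hαW : MDifferentiableAt I 𝓘(ℝ, ℝ) (fun q => α q (W q)) p) :
    extDerivOne I α p (V p) (W p) =
      dFun I (fun q => α q (W q)) p (V p) - dFun I (fun q => α q (V q)) p (W p)
        - α p (VectorField.mlieBracket I V W p) := by
  have key (U : VField I (N := N)) (hU : SmoothVField I U)
     (hαU : MDifferentiableAt I 𝓘(ℝ, ℝ) (fun q => α q (U q)) p) (v : TangentSpace I p) :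
     dFun I (fun q => α q (U q)) p v = 
      fderiv ℝ (oneFormInChart I α p) (extChartAt I p p) (v : E) (U p : E)
        + α p (fderiv ℝ (vFieldInChart U p) (extChartAt I p p) (v : E) : E) := by
    -- The pairing `α(U)` read in the chart is the pairing of the two chart representations; the
    -- product rule then gives both terms.
    have h1 : (fun q => α q (U q)) ∘ (extChartAt I p).symm =ᶠ[𝓝 (extChartAt I p p)]
        fun y => oneFormInChart I α p y (vFieldInChart U p y) := by
      filter_upwards [eventually_mem_extChartAt_target p] with y hy
      rw [oneFormInChart_apply, chartSymmDeriv_vFieldInChart U hy]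
      rfl
    have hU' := differentiableAt_vFieldInChart hU p
    have h2 := mfderiv_eq_fderiv_inChart hαU v
    rw [h1.fderiv_eq, fderiv_clm_apply hα hU'] at h2
    refine h2.trans ?_
    change oneFormInChart I α p _ (fderiv ℝ (vFieldInChart U p) (extChartAt I p p) (v : E))
      + fderiv ℝ (oneFormInChart I α p) (extChartAt I p p) (v : E) (vFieldInChart U p _) = _
    rw [oneFormInChart_self, add_comm, vFieldInChart_self]
  rw [key W hW hαW, key V hV hαV, extDerivOne_apply_inChart, mlieBracket_eq_inChart]
  have h : ∀ a b : E, α p (a - b : E) = α p a - α p b := fun a b => map_sub (α p) a b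
  rw [h]
  ring
end
end GenSasaki
end

/-! ### Global extensions of local fields and tests of smoothness -/

noncomputable section
namespace GenSasaki

open Bundle Set
open scoped Topology

set_option linter.unusedSectionVars false
section
variable {E : Type*} [NormedAddCommGroup E] [NormedSpace ℝ E] [FiniteDimensional ℝ E]
  {H : Type*} [TopologicalSpace H] {I : ModelWithCorners ℝ E H} [I.Boundaryless]
  {N : Type*} [TopologicalSpace N] [ChartedSpace H N] [IsManifold I ∞ N]

/-- A bump function cuts off a field with constant components in the trivialization at `p`. Such
fields supply local frames by global sections, so smoothness of a tensor near `p` can be tested on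
global fields. -/
theorem exists_smoothVField_const_inChart [T2Space N] (p : N) (e : E) :
    ∃ X : VField I (N := N), SmoothVField I X ∧
      ∀ᶠ q in 𝓝 p, X q = (trivializationAt E (TangentSpace I) p).symmL ℝ q e := by
  obtain ⟨f⟩ : Nonempty (SmoothBumpFunction I p) := inferInstance
  set t := trivializationAt E (TangentSpace I : N → Type _) p with ht
  refine ⟨(fun q => f q • t.symmL ℝ q e), ?_, ?_⟩
  · refine ContMDiffOn.smul_section_of_tsupport (u := t.baseSet) (f.contMDiff.contMDiffOn)
      t.open_baseSet ?_ ?_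
    · simpa [ht] using f.tsupport_subset_chartAt_source
    · rw [t.contMDiffOn_section_baseSet_iff]
      refine (contMDiffOn_const (c := e)).congr fun q hq => ?_
      simp [hq]
  · filter_upwards [f.eventuallyEq_one] with q hq
    simp [hq, ht]

theorem contMDiffAt_clm_of_apply {F : Type*} [NormedAddCommGroup F] [NormedSpace ℝ F]
    {f : N → E →L[ℝ] F} {p : N} (h : ∀ e, ContMDiffAt I 𝓘(ℝ, F) ∞ (fun q => f q e) p) :
    ContMDiffAt I 𝓘(ℝ, E →L[ℝ] F) ∞ f p := by
  let b := Module.finBasis ℝ E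
  have e : f = fun q => ∑ i, ContinuousLinearMap.smulRightL ℝ E F
      (LinearMap.toContinuousLinearMap (b.coord i)) (f q (b i)) := by
    funext q
    ext v
    conv_lhs => rw [← b.sum_repr v]
    simp only [map_sum, map_smul]
    simp
  rw [e]
  exact ContMDiffAt.sum fun i _ => (ContinuousLinearMap.contMDiffAt _).comp p (h (b i))

theorem exists_smoothVField_apply_eq [T2Space N] (p : N) (v : TangentSpace I p) :
    ∃ X : VField I (N := N), SmoothVField I X ∧ X p = v := by
  set t := trivializationAt E (TangentSpace I : N → Type _) p with ht
  obtain ⟨X, hX, h⟩ := exists_smoothVField_const_inChart (I := I) p (t.continuousLinearMapAt ℝ p v)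
  exact ⟨X, hX, by rw [h.self_of_nhds]; exact t.symmL_continuousLinearMapAt (by simp [ht]) v⟩

/-- Smoothness of a 1-form can be tested on smooth vector fields. -/
theorem smoothOneForm_of_apply [T2Space N] {α : OneForm I (N := N)}
    (h : ∀ X : VField I (N := N), SmoothVField I X →
      ContMDiff I 𝓘(ℝ, ℝ) ∞ (fun q => α q (X q))) : SmoothOneForm I α := by
  intro p
  rw [contMDiffAt_hom_bundle]
  refine ⟨contMDiffAt_id, contMDiffAt_clm_of_apply fun e => ?_⟩
  obtain ⟨X, hX, hXe⟩ := exists_smoothVField_const_inChart (I := I) p e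
  refine (h X hX p).congr_of_eventuallyEq ?_
  filter_upwards [hXe] with q hq
  rw [hq]
  simp only [ContinuousLinearMap.inCoordinates, ContinuousLinearMap.comp_apply]
  exact congrArg (fun L : ℝ →L[ℝ] ℝ => L _) (Bundle.Trivial.continuousLinearMapAt_trivialization ℝ N ℝ q)

theorem SmoothOneForm.apply {α : OneForm I (N := N)} (hα : SmoothOneForm I α)
    {X : VField I (N := N)} (hX : SmoothVField I X) :
    ContMDiff I 𝓘(ℝ, ℝ) ∞ (fun q => α q (X q)) := by
  intro p
  have := ContMDiffAt.clm_bundle_apply (F₂ := ℝ) (E₂ := Bundle.Trivial N ℝ) (n := ∞) (b := fun q : N => q) (hα p) (hX p)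
  rw [contMDiffAt_totalSpace] at this
  exact this.2

theorem SmoothEndField.apply {F : EndField I (N := N)} (hF : SmoothEndField I F)
    {X : VField I (N := N)} (hX : SmoothVField I X) : SmoothVField I (fun q => F q (X q)) := 
  fun p => ContMDiffAt.clm_bundle_apply (n := ∞) (b := fun q : N => q) (hF p) (hX p)

theorem SmoothBilinField.apply {b : BilinField I (N := N)} (hb : SmoothBilinField I b)
    {X Y : VField I (N := N)} (hX : SmoothVField I X) (hY : SmoothVField I Y) :
    ContMDiff I 𝓘(ℝ, ℝ) ∞ (fun q => b q (X q) (Y q)) := by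
  intro p
  have := ContMDiffAt.clm_bundle_apply₂ (F₃ := ℝ) (E₃ := Bundle.Trivial N ℝ) (n := ∞) (b := fun q : N => q) (hb p) (hX p) (hY p)
  rw [contMDiffAt_totalSpace] at this
  exact this.2

/-- The components of `α` in the chart are its values on the coordinate fields, which agree near `p`
with global smooth fields. -/
theorem differentiableAt_oneFormInChart [T2Space N] {α : OneForm I (N := N)} (hα : SmoothOneForm I α) (p : N) :
   DifferentiableAt ℝ (oneFormInChart I α p) (extChartAt I p p) := by
  refine (contMDiffAt_clm_of_apply (I := 𝓘(ℝ, E)) fun e => ?_).contDiffAt.differentiableAt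
    (by simp)
  obtain ⟨X, hX, hXe⟩ := exists_smoothVField_const_inChart (I := I) p e
  refine (contDiffAt_comp_extChartAt_symm (hα.apply hX p)).contMDiffAt.congr_of_eventuallyEq ?_
  have hc := continuousAt_extChartAt_symm (I := I) p
  rw [ContinuousAt, extChartAt_to_inv] at hc
  have hXe' := hc.eventually hXe
  filter_upwards [eventually_mem_extChartAt_target p, hXe'] with y hy hy'
  have hs : (extChartAt I p).symm y ∈ (chartAt H p).source := by
    rw [← extChartAt_source (I := I)]
    exact (extChartAt I p).map_target hy
  rw [oneFormInChart_apply, Function.comp_apply, hy', TangentBundle.symmL_trivializationAt hs,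
    (extChartAt I p).right_inv hy]
  rfl

theorem contMDiff_dFun_apply {f : N → ℝ} (hf : ContMDiff I 𝓘(ℝ, ℝ) ∞ f)
    {X : VField I (N := N)} (hX : SmoothVField I X) :
    ContMDiff I 𝓘(ℝ, ℝ) ∞ (fun q => dFun I f q (X q)) := by
  have h1 : ContMDiff I.tangent 𝓘(ℝ, ℝ).tangent ∞ (tangentMap I 𝓘(ℝ, ℝ) f) := hf.contMDiff_tangentMap (by simp)
  exact (contMDiff_snd_tangentBundle_modelSpace ℝ 𝓘(ℝ, ℝ)).comp (h1.comp hX)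

theorem contMDiff_mlieBracket {X Y : VField I (N := N)} (hX : SmoothVField I X) (hY : SmoothVField I Y) :
   SmoothVField I (VectorField.mlieBracket I X Y) := by
  have : IsManifold I (∞ + 1) N := inferInstanceAs (IsManifold I ∞ N)
  have : IsManifold I (minSmoothness ℝ 2) N := by
    rw [minSmoothness_of_isRCLikeNormedField]; infer_instance
  exact ContDiff.mlieBracket_vectorField (m := ⊤) (n := ⊤) hX hY (by simp)
end
end GenSasaki
end

/-! ### Derivations, musical maps and smooth vector fields as a Lie ring -/

noncomputable section
namespace GenSasaki

open Bundle Set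
open scoped Topology

set_option linter.unusedSectionVars false
section
variable {E : Type*} [NormedAddCommGroup E] [NormedSpace ℝ E] [FiniteDimensional ℝ E]
  {H : Type*} [TopologicalSpace H] {I : ModelWithCorners ℝ E H} [I.Boundaryless]
  {N : Type*} [TopologicalSpace N] [ChartedSpace H N] [IsManifold I ∞ N]

theorem two_le_infty : (2 : WithTop ℕ∞) ≤ ∞ := ENat.LEInfty.out

theorem oneFormInChart_dFun {f : N → ℝ} (hf : ContMDiff I 𝓘(ℝ, ℝ) ∞ f) (p : N) :
    oneFormInChart I (dFun I f) p =ᶠ[𝓝 (extChartAt I p p)]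
      fderiv ℝ (f ∘ (extChartAt I p).symm) := by
  filter_upwards [eventually_mem_extChartAt_target p] with y hy
  have h := mfderiv_comp_mfderivWithin (I := 𝓘(ℝ, E)) (I' := I) (I'' := 𝓘(ℝ, ℝ)) (s := range I) y
    (hf.mdifferentiable (by simp) _) (mdifferentiableWithinAt_extChartAt_symm hy)
    (I.uniqueMDiffOn _ (extChartAt_target_subset_range p hy))
  rw [mfderivWithin_eq_fderivWithin, I.range_eq_univ, fderivWithin_univ] at h
  unfold oneFormInChart
  rw [I.range_eq_univ]
  exact h.symm

/-- Symmetry of the second derivative in the chart. -/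
theorem extDerivOne_dFun {f : N → ℝ} (hf : ContMDiff I 𝓘(ℝ, ℝ) ∞ f) (p : N)
    (v w : TangentSpace I p) : extDerivOne I (dFun I f) p v w = 0 := by
  have hs : IsSymmSndFDerivAt ℝ (f ∘ (extChartAt I p).symm) (extChartAt I p p) :=
    (contDiffAt_comp_extChartAt_symm (hf p)).isSymmSndFDerivAt
      (by rw [minSmoothness_of_isRCLikeNormedField]; exact two_le_infty)
  rw [extDerivOne_apply_inChart, (oneFormInChart_dFun hf p).fderiv_eq, sub_eq_zero]
  exact hs _ _

/-- The Lie bracket of vector fields is the commutator of derivations. -/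
theorem dFun_mlieBracket {f : N → ℝ} (hf : ContMDiff I 𝓘(ℝ, ℝ) ∞ f) {V W : VField I (N := N)}
    (hV : SmoothVField I V) (hW : SmoothVField I W) (p : N) :
    dFun I f p (VectorField.mlieBracket I V W p) =
      dFun I (fun q => dFun I f q (W q)) p (V p) - dFun I (fun q => dFun I f q (V q)) p (W p) := by
  have h := extDerivOne_apply_eq (α := dFun I f) (p := p) ?_ hV hW
    ((contMDiff_dFun_apply hf hV).mdifferentiable (by simp) p)
    ((contMDiff_dFun_apply hf hW).mdifferentiable (by simp) p)
  · rw [extDerivOne_dFun hf] at h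
    linarith
  · refine DifferentiableAt.congr_of_eventuallyEq ?_ (oneFormInChart_dFun hf p)
    exact ((contDiffAt_comp_extChartAt_symm (hf p)).fderiv_right (m := 1)
      (by rw [one_add_one_eq_two]; exact two_le_infty)).differentiableAt (by simp)

theorem isInvertible_of_injective {c : E →L[ℝ] E →L[ℝ] ℝ} (hc : Function.Injective c) :
    c.IsInvertible := by
  have hr : Module.finrank ℝ E = Module.finrank ℝ (E →L[ℝ] ℝ) := by
    rw [← (LinearMap.toContinuousLinearMap (𝕜 := ℝ) (E := E) (F' := ℝ)).finrank_eq]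
    exact (Subspace.dual_finrank_eq).symm
  exact ⟨(LinearEquiv.ofInjectiveOfFinrankEq c.toLinearMap hc hr).toContinuousLinearEquiv,
    by ext; rfl⟩

/-- A vector field is smooth if its image under the musical map of a nondegenerate tensor field is. -/
theorem smoothVField_of_nondegenerate [T2Space N] {b : BilinField I (N := N)}
    (hb : ∀ X Y : VField I (N := N), SmoothVField I X → SmoothVField I Y →
      ContMDiff I 𝓘(ℝ, ℝ) ∞ (fun q => b q (X q) (Y q)))
    (hn : ∀ (p : N) (v : TangentSpace I p), b p v = 0 → v = 0) {X : VField I (N := N)}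
    (hX : ∀ Y : VField I (N := N), SmoothVField I Y →
      ContMDiff I 𝓘(ℝ, ℝ) ∞ (fun q => b q (X q) (Y q))) : SmoothVField I X := by
  intro p
  set t := trivializationAt E (TangentSpace I : N → Type _) p with ht
  have hp : p ∈ t.baseSet := by simp [ht]
  -- `B` is the matrix of `b` and `x` below the component vector of `X`, both in the trivialization
  -- at `p`. Then `x = B⁻¹ (B x)` is smooth because inversion of linear maps is.
  let B : N → E →L[ℝ] E →L[ℝ] ℝ := fun q =>
    let c : E →L[ℝ] E →L[ℝ] ℝ := b q
    let s : E →L[ℝ] E := t.symmL ℝ q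
    c.bilinearComp s s
  have hBa (q : N) (e e' : E) : B q e e' = b q (t.symmL ℝ q e) (t.symmL ℝ q e') := rfl
  have hB : ContMDiffAt I 𝓘(ℝ, E →L[ℝ] E →L[ℝ] ℝ) ∞ B p := by
    refine contMDiffAt_clm_of_apply fun e => contMDiffAt_clm_of_apply fun e' => ?_
    obtain ⟨X, hX, hXe⟩ := exists_smoothVField_const_inChart (I := I) p e
    obtain ⟨Y, hY, hYe⟩ := exists_smoothVField_const_inChart (I := I) p e'
    refine (hb X Y hX hY p).congr_of_eventuallyEq ?_
    filter_upwards [hXe, hYe] with q hq hq'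
    rw [hq, hq']
    rfl
  let x : N → E := fun q => t.continuousLinearMapAt ℝ q (X q)
  have hBx : ContMDiffAt I 𝓘(ℝ, E →L[ℝ] ℝ) ∞ (fun q => B q (x q)) p := by
    refine contMDiffAt_clm_of_apply fun e' => ?_
    obtain ⟨Y, hY, hYe⟩ := exists_smoothVField_const_inChart (I := I) p e'
    refine (hX Y hY p).congr_of_eventuallyEq ?_
    filter_upwards [hYe, t.open_baseSet.mem_nhds hp] with q hq' hq
    rw [hq', hBa, t.symmL_continuousLinearMapAt hq]
  have hinj : ∀ q ∈ t.baseSet, Function.Injective (B q) := by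
    intro q hq
    rw [injective_iff_map_eq_zero]
    intro v hv
    have : t.symmL ℝ q v = 0 := by
      apply hn
      ext w
      have := congrArg (fun L : E →L[ℝ] ℝ => L (t.continuousLinearMapAt ℝ q w)) hv
      rw [hBa, t.symmL_continuousLinearMapAt hq] at this
      exact this
    rw [← t.continuousLinearMapAt_symmL (R := ℝ) hq v, this, map_zero]
  have hinv : ∀ q ∈ t.baseSet, (B q).IsInvertible := fun q hq =>
    isInvertible_of_injective (hinj q hq)
  have hx : ContMDiffAt I 𝓘(ℝ, E) ∞ x p := by
    have h1 : ContMDiffAt I 𝓘(ℝ, (E →L[ℝ] ℝ) →L[ℝ] E) ∞ (fun q => (B q).inverse) p := by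
      obtain ⟨e, he⟩ := hinv p hp
      have : ContDiffAt ℝ ∞ ContinuousLinearMap.inverse (B p) := by
        rw [← he]; exact contDiffAt_map_inverse e
      exact this.contMDiffAt.comp p hB
    refine (h1.clm_apply hBx).congr_of_eventuallyEq ?_
    filter_upwards [t.open_baseSet.mem_nhds hp] with q hq
    exact ((hinv q hq).inverse_apply_self _).symm
  rw [contMDiffAt_section]
  refine hx.congr_of_eventuallyEq ?_
  filter_upwards [t.open_baseSet.mem_nhds hp] with q hq
  exact (t.continuousLinearMapAt_apply_of_mem ℝ hq _).symm

/-! ## The Lie ring of smooth vector fields -/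

variable (I N) in
/-- Smooth vector fields. -/
abbrev SField : Type _ := ContMDiffSection I E ∞ (fun p : N => TangentSpace I p)

variable (I N) in
/-- Smooth functions. -/
abbrev SFun : Type _ := ContMDiffMap I 𝓘(ℝ, ℝ) N ℝ ∞

theorem SField.smooth (X : SField I N) : SmoothVField I (fun q => X q) := X.contMDiff

instance : Bracket (SField I N) (SField I N) where
  bracket X Y := ⟨VectorField.mlieBracket I (fun q => X q) (fun q => Y q),
    contMDiff_mlieBracket X.smooth Y.smooth⟩

instance : Bracket (SField I N) (SFun I N) where
  bracket X f := ⟨fun q => dFun I f q (X q), contMDiff_dFun_apply f.contMDiff X.smooth⟩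

theorem lie_sFun_apply (X : SField I N) (f : SFun I N) (p : N) :
    ⁅X, f⁆ p = dFun I (fun q => f q) p (X p) := rfl

theorem dFun_add {f g : N → ℝ} {p : N} (hf : MDifferentiableAt I 𝓘(ℝ, ℝ) f p)
    (hg : MDifferentiableAt I 𝓘(ℝ, ℝ) g p) (v : TangentSpace I p) :
    dFun I (fun q => f q + g q) p v = dFun I f p v + dFun I g p v :=
  congrArg (fun L : TangentSpace I p →L[ℝ] ℝ => L v) (mfderiv_add hf hg)

instance : LieRing (SField I N) where
  add_lie X Y Z := by
    ext p
    exact VectorField.mlieBracket_add_left (X.mdifferentiableAt) (Y.mdifferentiableAt)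
  lie_add X Y Z := by
    ext p
    exact VectorField.mlieBracket_add_right (Y.mdifferentiableAt) (Z.mdifferentiableAt)
  lie_self X := by
    ext p
    have h := VectorField.mlieBracket_swap_apply (I := I) (V := fun q => X q) (W := fun q => X q)
      (x := p)
    have h' : ∀ v : E, v = -v → v = 0 := fun v hv => by
      have : (2 : ℝ) • v = 0 := by rw [two_smul]; nth_rewrite 1 [hv]; simp
      exact (smul_eq_zero.1 this).resolve_left two_ne_zero
    exact h' _ h
  leibniz_lie X Y Z := by
    have : IsManifold I (minSmoothness ℝ 3) N := by
      rw [minSmoothness_of_isRCLikeNormedField]; infer_instance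
    have h (X : SField I N) : ContMDiff I I.tangent (minSmoothness ℝ 2)
        (fun q => (⟨q, X q⟩ : TangentBundle I N)) := X.smooth.of_le (by
      rw [minSmoothness_of_isRCLikeNormedField]; exact two_le_infty)
    ext p
    exact congrFun (VectorField.leibniz_identity_mlieBracket (h X) (h Y) (h Z)) p

/-- Only the commutator formula `dFun_mlieBracket` and additivity are required here; the product
rule for functions is the separate `lie_mul_sFun`. -/
instance : LieRingModule (SField I N) (SFun I N) where
  add_lie X Y f := by
    ext p
    exact map_add (dFun I (fun q => f q) p) (X p) (Y p)
  lie_add X f g := by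
    ext p
    exact dFun_add (f.contMDiff.mdifferentiable (by simp) p)
      (g.contMDiff.mdifferentiable (by simp) p) (X p)
  leibniz_lie X Y f := by
    ext p
    have h := dFun_mlieBracket f.contMDiff X.smooth Y.smooth p
    have e : dFun I (fun q => dFun I f q (Y q)) p (X p) = dFun I f p
      (VectorField.mlieBracket I (fun q => X q) (fun q => Y q) p) +
        dFun I (fun q => dFun I f q (X q)) p (Y p) := by linarith
    exact e

/-- The pairing of a 1-form with smooth vector fields. -/
def pairOne (α : OneForm I (N := N))
    (hα : ∀ X : SField I N, ContMDiff I 𝓘(ℝ, ℝ) ∞ (fun q => α q (X q))) :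
    SField I N →+ SFun I N where
  toFun X := ⟨fun q => α q (X q), hα X⟩
  map_zero' := by ext p; exact map_zero (α p)
  map_add' X Y := by ext p; exact map_add (α p) (X p) (Y p)

/-- Bilinear fields that are smooth on smooth vector fields. -/
def SmoothOnFields (b : BilinField I (N := N)) : Prop :=
  ∀ X Y : SField I N, ContMDiff I 𝓘(ℝ, ℝ) ∞ (fun q => b q (X q) (Y q))

/-- The pairing of a covariant 2-tensor field with smooth vector fields. -/
def pairTwo (b : BilinField I (N := N)) (hb : SmoothOnFields b) :
    SField I N →+ SField I N →+ SFun I N where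
  toFun X := pairOne (fun q => b q (X q)) (hb X)
  map_zero' := by
    ext Y p
    exact congrArg (fun L : TangentSpace I p →L[ℝ] ℝ => L (Y p)) (map_zero (b p))
  map_add' X X' := by
    ext Y p
    exact congrArg (fun L : TangentSpace I p →L[ℝ] ℝ => L (Y p)) (map_add (b p) (X p) (X' p))

/-- The action of an endomorphism field on smooth vector fields. -/
def endMap (F : EndField I (N := N))
    (hF : ∀ X : SField I N, SmoothVField I (fun q => F q (X q))) : SField I N →+ SField I N where
  toFun X := ⟨fun q => F q (X q), hF X⟩
  map_zero' := by ext p; exact map_zero (F p)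
  map_add' X Y := by ext p; exact map_add (F p) (X p) (Y p)

theorem extDerivOne_eq_dOne [T2Space N] {α : OneForm I (N := N)} (hα : SmoothOneForm I α)
    (X Y : SField I N) (p : N) :
    extDerivOne I α p (X p) (Y p) =
      dOne (pairOne α fun X => hα.apply X.smooth) X Y p :=
  extDerivOne_apply_eq (differentiableAt_oneFormInChart hα p) X.smooth Y.smooth
    ((hα.apply X.smooth).mdifferentiable (by simp) p)
    ((hα.apply Y.smooth).mdifferentiable (by simp) p)

theorem SField.exists_apply_eq [T2Space N] (p : N) (v : TangentSpace I p) :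
    ∃ X : SField I N, X p = v := by
  obtain ⟨X, hX, h⟩ := exists_smoothVField_apply_eq p v
  exact ⟨⟨X, hX⟩, h⟩

/-- Supplies the divisions by 2 and by 3 which the abstract identities assume of the coefficient
ring. -/
theorem SFun.eq_zero_of_nsmul (n : ℕ) (hn : n ≠ 0) (f : SFun I N) (h : (n : SFun I N) * f = 0) :
    f = 0 := by
  ext p
  have h1 := congrArg (fun f : SFun I N => f p) h
  have h2 : (n : ℝ) * f p = 0 := by
    rw [← nsmul_eq_mul] at h1 ⊢
    exact h1
  exact (mul_eq_zero.1 h2).resolve_left (by exact_mod_cast hn)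
end
end GenSasaki
end

noncomputable section
namespace GenSasaki

open Bundle Set
open scoped Topology

set_option linter.unusedSectionVars false

section
variable {E : Type*} [NormedAddCommGroup E] [NormedSpace ℝ E] [FiniteDimensional ℝ E]
  {H : Type*} [TopologicalSpace H] {I : ModelWithCorners ℝ E H} [I.Boundaryless]
  {N : Type*} [TopologicalSpace N] [ChartedSpace H N] [IsManifold I ∞ N] [T2Space N]

/-! ## The Courant bracket in terms of Lie brackets -/

theorem lieOne_apply {β : OneForm I (N := N)} (hβ : SmoothOneForm I β) (X W : SField I N) (p : N) :
    lieOne I (fun q => X q) β p (W p) =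
      (⁅X, (pairOne β fun X => hβ.apply X.smooth) W⁆
        - pairOne β (fun X => hβ.apply X.smooth) ⁅X, W⁆ : SFun I N) p := by
  have h := extDerivOne_eq_dOne hβ X W p
  have e : lieOne I (fun q => X q) β p (W p) = extDerivOne I β p (X p) (W p)
    + (⁅W, (pairOne β fun X => hβ.apply X.smooth) X⁆ : SFun I N) p := rfl
  rw [e, h]
  simp only [dOne, ContMDiffMap.coe_sub, Pi.sub_apply]
  ring

theorem SFun.two_apply (p : N) : (2 : SFun I N) p = 2 := by
  rw [← one_add_one_eq_two, ← one_add_one_eq_two]; rfl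

theorem two_mul_courant_snd {α β : OneForm I (N := N)} (hα : SmoothOneForm I α)
    (hβ : SmoothOneForm I β) (X Y W : SField I N) (p : N) :
    2 * (courant I (fun q => (X q, α q)) (fun q => (Y q, β q)) p).2 (W p) =
      courantTwo (pairOne α fun X => hα.apply X.smooth) (pairOne β fun X => hβ.apply X.smooth)
        X Y W p := by
  have e : (courant I (fun q => (X q, α q)) (fun q => (Y q, β q)) p).2 (W p) =
      lieOne I (fun q => X q) β p (W p) - lieOne I (fun q => Y q) α p (W p)
      + (1 / 2 : ℝ) * (⁅W, (pairOne α fun X => hα.apply X.smooth) Y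
        - (pairOne β fun X => hβ.apply X.smooth) X⁆ : SFun I N) p := rfl
  rw [e, lieOne_apply hβ, lieOne_apply hα]
  simp only [courantTwo, ContMDiffMap.coe_sub, ContMDiffMap.coe_add, ContMDiffMap.coe_mul,
    Pi.sub_apply, Pi.add_apply, Pi.mul_apply, SFun.two_apply]
  ring

theorem SmoothBilinField.smoothOnFields {b : BilinField I (N := N)} (hb : SmoothBilinField I b) :
    SmoothOnFields b := fun X Y => hb.apply X.smooth Y.smooth

theorem SmoothOnFields.smoothOneForm {b : BilinField I (N := N)} (hb : SmoothOnFields b)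
    (X : SField I N) : SmoothOneForm I (fun q => b q (X q)) :=
  smoothOneForm_of_apply fun Y hY => hb X ⟨Y, hY⟩

theorem bigField_ext {p : N} {x y : TBig I p} (h₁ : x.1 = y.1)
    (h₂ : ∀ W : SField I N, x.2 (W p) = y.2 (W p)) : x = y := by
  refine Prod.ext h₁ (ContinuousLinearMap.ext fun v => ?_)
  obtain ⟨W, rfl⟩ := SField.exists_apply_eq p v
  exact h₂ W

/-! ## Generalized Kähler structures induce `dω = ∓ J · dψ` -/

theorem neutral_smul_smul (p : N) (x y : TBig I p) (a c : ℝ) :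
    neutral I p (a • x) (c • y) = a * c * neutral I p x y := by
  have h₁ : x.2 (c • y.1) = c * x.2 y.1 := x.2.map_smul c y.1
  have h₂ : y.2 (a • x.1) = a * y.2 x.1 := y.2.map_smul a x.1
  change (a * x.2 (c • y.1) + c * y.2 (a • x.1)) / 2 = a * c * ((x.2 y.1 + y.2 x.1) / 2)
  rw [h₁, h₂]
  ring

/-- The section of the graph of `b` over the vector field `X`. -/
def graphSection (b : BilinField I (N := N)) (X : SField I N) : BigField I (N := N) :=
  fun q => (X q, b q (X q))

theorem smoothBigField_graphSection {b : BilinField I (N := N)} (hb : SmoothOnFields b)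
    (X : SField I N) : SmoothBigField I (graphSection b X) := ⟨X.smooth, hb.smoothOneForm X⟩

theorem two_mul_courant_graphSection {b : BilinField I (N := N)} (hb : SmoothOnFields b)
    (X Y W : SField I N) (p : N) :
    2 * (courant I (graphSection b X) (graphSection b Y) p).2 (W p) =
      courantTwo (pairTwo b hb X) (pairTwo b hb Y) X Y W p :=
  two_mul_courant_snd (hb.smoothOneForm X) (hb.smoothOneForm Y) X Y W p

/-- Needed on `V_-`, where `♯_G ∘ 𝒥` carries the section over `X` to the section over `-JX`. -/
theorem courant_graphSection_neg_left {b : BilinField I (N := N)} (hb : SmoothOnFields b)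
    (X Y : SField I N) (p : N) :
    courant I (graphSection b (-X)) (graphSection b Y) p
      = -courant I (graphSection b X) (graphSection b Y) p := by
  refine bigField_ext ?_ fun W => ?_
  · exact congrArg (fun Z : SField I N => Z p) (neg_lie X Y)
  · have h₁ := two_mul_courant_graphSection hb (-X) Y W p
    have h₂ := two_mul_courant_graphSection hb X Y W p
    have e : courantTwo (pairTwo b hb (-X)) (pairTwo b hb Y) (-X) Y W
        = -courantTwo (pairTwo b hb X) (pairTwo b hb Y) X Y W := by
      simp only [courantTwo, map_neg, neg_lie, lie_neg, AddMonoidHom.neg_apply, lie_sub]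
      ring
    rw [e] at h₁
    have h₃ : 2 * (courant I (graphSection b (-X)) (graphSection b Y) p).2 (W p)
      = -(2 * (courant I (graphSection b X) (graphSection b Y) p).2 (W p)) := by rw [h₁, h₂]; rfl
    have h₄ : (courant I (graphSection b (-X)) (graphSection b Y) p).2 (W p)
      = -((courant I (graphSection b X) (graphSection b Y) p).2 (W p)) := by linarith
    exact h₄

theorem courant_graphSection_neg_right {b : BilinField I (N := N)} (hb : SmoothOnFields b)
    (X Y : SField I N) (p : N) :
    courant I (graphSection b X) (graphSection b (-Y)) p
      = -courant I (graphSection b X) (graphSection b Y) p := by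
  refine bigField_ext ?_ fun W => ?_
  · exact congrArg (fun Z : SField I N => Z p) (lie_neg X Y)
  · have h₁ := two_mul_courant_graphSection hb X (-Y) W p
    have h₂ := two_mul_courant_graphSection hb X Y W p
    have e : courantTwo (pairTwo b hb X) (pairTwo b hb (-Y)) X (-Y) W
        = -courantTwo (pairTwo b hb X) (pairTwo b hb Y) X Y W := by
      simp only [courantTwo, map_neg, neg_lie, lie_neg, AddMonoidHom.neg_apply, lie_sub]
      ring
    rw [e] at h₁
    have h₃ : 2 * (courant I (graphSection b X) (graphSection b (-Y)) p).2 (W p)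
      = -(2 * (courant I (graphSection b X) (graphSection b Y) p).2 (W p)) := by rw [h₁, h₂]; rfl
    have h₄ : (courant I (graphSection b X) (graphSection b (-Y)) p).2 (W p)
      = -((courant I (graphSection b X) (graphSection b Y) p).2 (W p)) := by linarith
    exact h₄

/-- If the Courant brackets of sections of the graph of `b` are compatible with `J`, then
the combination of brackets that occurs in the torsion is again a section of the graph. -/
theorem IsGenKahler.courant_sub_courant {S 𝒥 : BigEnd I (N := N)} (h : IsGenKahler I S 𝒥)
    {b : BilinField I (N := N)} (hb : SmoothOnFields b) {J : SField I N →+ SField I N} {ε : ℝ}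
    (hε : ε = 1 ∨ ε = -1)
    (h𝒥 : ∀ (X : SField I N) (q : N), 𝒥 q (graphSection b X q) = graphSection b (J X) q)
    (hS : ∀ (X : SField I N) (q : N), S q (graphSection b X q) = ε • graphSection b X q)
    (X Y : SField I N) (p : N) :
    S p (courant I (graphSection b (J X)) (graphSection b (J Y)) p
        - courant I (graphSection b X) (graphSection b Y) p)
      = ε • (courant I (graphSection b (J X)) (graphSection b (J Y)) p
        - courant I (graphSection b X) (graphSection b Y) p) := by
  have t₁ := h.integrable.torsion _ _ (smoothBigField_graphSection hb X)
    (smoothBigField_graphSection hb Y) p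
  have t₂ := h.integrable_compl.torsion _ _ (smoothBigField_graphSection hb X)
    (smoothBigField_graphSection hb Y) p
  -- On an eigenbundle of `S` with eigenvalue `ε`, the complementary structure induces `ε J`.
  have e₂ (X : SField I N) : (fun q => (S q).comp (𝒥 q) (graphSection b X q))
      = fun q => ε • graphSection b (J X) q := by
    funext q
    exact (congrArg (S q) (h𝒥 X q)).trans (hS (J X) q)
  simp only [courantNijenhuis, h𝒥, h.integrable.sq] at t₁
  have sq₂ := h.integrable_compl.sq p
  simp only [courantNijenhuis, sq₂, e₂] at t₂
  have t₂' : courant I (graphSection b (J X)) (graphSection b (J Y)) p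
      - ε • S p (𝒥 p (courant I (graphSection b X) (graphSection b (J Y)) p))
      - ε • S p (𝒥 p (courant I (graphSection b (J X)) (graphSection b Y) p))
      - courant I (graphSection b X) (graphSection b Y) p = 0 := by
    rcases hε with rfl | rfl
    · simp only [one_smul] at t₂ ⊢
      rw [← t₂]
      exact sub_eq_add_neg _ _
    · have e (X : SField I N) : (fun q => (-1 : ℝ) • graphSection b (J X) q)
          = graphSection b (-J X) := by
        funext q
        refine Prod.ext (neg_one_smul ℝ (J X q)) ?_
        exact (neg_one_smul ℝ (b q (J X q))).trans (map_neg (b q) (J X q)).symm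
      simp only [e, courant_graphSection_neg_left hb, courant_graphSection_neg_right hb,
        neg_neg, ContinuousLinearMap.map_neg] at t₂
      have m (x : TBig I p) : (-1 : ℝ) • x = -x := neg_one_smul ℝ x
      rw [m, m, ← t₂]
      exact sub_eq_add_neg _ _
  generalize courant I (graphSection b (J X)) (graphSection b (J Y)) p = A at *
  generalize courant I (graphSection b X) (graphSection b Y) p = A' at *
  generalize courant I (graphSection b X) (graphSection b (J Y)) p = B at *
  generalize courant I (graphSection b (J X)) (graphSection b Y) p = B' at *
  -- The torsion of `𝒥` gives `A - A' = 𝒥(B + B')`, that of `S ∘ 𝒥` gives `A - A' = ε S 𝒥(B + B')`.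
  -- Applying `S` to the first and comparing shows that `A - A'` is an `ε`-eigenvector.
  have e₁ : A - A' = 𝒥 p B + 𝒥 p B' := by
    rw [← sub_eq_zero, ← t₁]; abel
  have e₃ : A - A' = ε • (S p (𝒥 p B) + S p (𝒥 p B')) := by
    rw [← sub_eq_zero, ← t₂', smul_add]; abel
  have hεε : ε * ε = 1 := by rcases hε with rfl | rfl <;> norm_num
  have e₄ : S p (A - A') = S p (𝒥 p B) + S p (𝒥 p B') := by
    rw [e₁]; exact (S p).map_add _ _
  rw [e₄, e₃, smul_smul, hεε, one_smul]

/-- The fundamental forms of the almost complex structures induced by a generalized Kähler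
structure. -/
theorem IsGenKahler.dTwo_fundamental {S 𝒥 : BigEnd I (N := N)} (h : IsGenKahler I S 𝒥)
    {ψ γ : BilinField I (N := N)} (hψ : SmoothOnFields ψ) (hγ : SmoothOnFields γ)
    (hψa : ∀ (p : N) (v w : TangentSpace I p), ψ p v w = -ψ p w v)
    (hγs : ∀ (p : N) (v w : TangentSpace I p), γ p v w = γ p w v)
    {J : EndField I (N := N)} (hJ : ∀ X : SField I N, SmoothVField I (fun q => J q (X q)))
    (sq : ∀ (p : N) (v : TangentSpace I p), J p (J p v) = -v)
    (skew : ∀ (p : N) (v w : TangentSpace I p), γ p (J p v) w = -γ p v (J p w)) {ε : ℝ}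
    (hε : ε = 1 ∨ ε = -1)
    (h𝒥 : ∀ (q : N) (v : TangentSpace I q),
      𝒥 q (v, ψ q v + γ q v) = (J q v, ψ q (J q v) + γ q (J q v)))
    (hS : ∀ (q : N) (v : TangentSpace I q), S q (v, ψ q v + γ q v) = ε • (v, ψ q v + γ q v))
    (hS' : ∀ (q : N) (v : TangentSpace I q), S q (v, ψ q v - γ q v) = -ε • (v, ψ q v - γ q v))
    (X Y W : SField I N) :
    dTwo ((pairTwo γ hγ).comp (endMap J hJ)) X Y W
      + (dTwo (pairTwo ψ hψ) (endMap J hJ X) Y W + dTwo (pairTwo ψ hψ) X (endMap J hJ Y) W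
        + dTwo (pairTwo ψ hψ) X Y (endMap J hJ W)) = 0 := by
  set b : BilinField I (N := N) := fun q => ψ q + γ q with hb_def
  have hb : SmoothOnFields b := fun X Y => (hψ X Y).add (hγ X Y)
  have hbp (X : SField I N) : pairTwo b hb X = pairTwo ψ hψ X + pairTwo γ hγ X := by
    ext Y p; rfl
  refine dTwo_fundamental_of_courant _ _ _ (fun X Y => ?_) (fun X Y => ?_)
    (fun c hc => SFun.eq_zero_of_nsmul 2 two_ne_zero c (by exact_mod_cast hc)) (fun X => ?_)
    (fun X Y => ?_) (fun X Y W => ?_) X Y W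
  · ext p; exact hψa p _ _
  · ext p; exact hγs p _ _
  · ext p; exact sq p _
  · ext p; exact skew p _ _
  · ext p
    have key := h.courant_sub_courant hb (J := endMap J hJ) hε (fun X q => h𝒥 q (X q))
      (fun X q => hS q (X q)) X Y p
    have h₁ := two_mul_courant_graphSection hb (endMap J hJ X) (endMap J hJ Y) W p
    have h₂ := two_mul_courant_graphSection hb X Y W p
    -- The eigenbundles of the isometry `S` are orthogonal for the neutral metric. Orthogonality to
    -- `(W, ψ W - γ W)` in the opposite eigenbundle expresses that the bracket difference lies in
    -- the graph of `ψ + γ`.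
    have iso := h.metric.isometry p (courant I (graphSection b (endMap J hJ X))
      (graphSection b (endMap J hJ Y)) p - courant I (graphSection b X) (graphSection b Y) p)
      (W p, ψ p (W p) - γ p (W p))
    rw [key, hS'] at iso
    set A := courant I (graphSection b (endMap J hJ X)) (graphSection b (endMap J hJ Y)) p with hA
    set A' := courant I (graphSection b X) (graphSection b Y) p with hA'
    have i₁ : neutral I p (ε • (A - A')) (-ε • (W p, ψ p (W p) - γ p (W p)))
      = -(ε * ε) * neutral I p (A - A') (W p, ψ p (W p) - γ p (W p)) := by
      rw [neutral_smul_smul]; ring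
    have hεε : ε * ε = 1 := by rcases hε with rfl | rfl <;> norm_num
    rw [i₁, hεε] at iso
    have i₂ : neutral I p (A - A') (W p, ψ p (W p) - γ p (W p)) = 0 := by linarith
    have i₃ : (A - A').2 (W p) + (ψ p (W p) (A - A').1 - γ p (W p) (A - A').1) = 0 := by
      have : ((A - A').2 (W p) + (ψ p (W p) (A - A').1 - γ p (W p) (A - A').1)) / 2 = 0 := i₂
      linarith
    rw [hψa, hγs] at i₃
    have i₄ : (A - A').2 (W p) = A.2 (W p) - A'.2 (W p) := rfl
    have i₅ : (A - A').1 = (⁅endMap J hJ X, endMap J hJ Y⁆ - ⁅X, Y⁆ : SField I N) p := rfl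
    rw [i₄, i₅] at i₃
    rw [← hbp, ← hbp, ← hbp, ← hbp]
    simp only [ContMDiffMap.coe_sub, ContMDiffMap.coe_add, ContMDiffMap.coe_mul,
      Pi.sub_apply, Pi.add_apply, Pi.mul_apply, SFun.two_apply]
    rw [← h₁, ← h₂]
    have i₆ (Z : SField I N) : pairTwo ψ hψ Z W p = ψ p (Z p) (W p) := rfl
    have i₇ (Z : SField I N) : pairTwo γ hγ Z W p = γ p (Z p) (W p) := rfl
    rw [i₆, i₇]
    linarith
end
end GenSasaki
end

noncomputable section
namespace GenSasaki

open Bundle Set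
open scoped Topology

set_option linter.unusedSectionVars false

section
variable {E : Type*} [NormedAddCommGroup E] [NormedSpace ℝ E] [FiniteDimensional ℝ E]
  {H : Type*} [TopologicalSpace H] {I : ModelWithCorners ℝ E H} [I.Boundaryless]
  {N : Type*} [TopologicalSpace N] [ChartedSpace H N] [IsManifold I ∞ N] [T2Space N]

/-! ## The generalized Kähler structure of a pair of Kähler structures with the same metric -/

/-- Riemannian metrics, with smoothness tested on smooth vector fields. -/
structure IsMetricField (γ : BilinField I (N := N)) : Prop where
  symm : ∀ (p : N) (v w : TangentSpace I p), γ p v w = γ p w v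
  pos : ∀ (p : N) (v : TangentSpace I p), v ≠ 0 → 0 < γ p v v
  smooth : SmoothOnFields γ

/-- The inverse of the musical map of `γ`. -/
def sharpField (γ : BilinField I (N := N)) (p : N) :
    (TangentSpace I p →L[ℝ] ℝ) →L[ℝ] TangentSpace I p := (γ p).inverse

namespace IsMetricField

variable {γ : BilinField I (N := N)} (hγ : IsMetricField γ)
include hγ

theorem eq_zero_of_apply_self {p : N} {v : TangentSpace I p} (h : γ p v v = 0) : v = 0 := by
  by_contra hv
  exact (hγ.pos p v hv).ne' h

theorem eq_zero_of_apply {p : N} {v : TangentSpace I p} (h : γ p v = 0) : v = 0 :=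
  hγ.eq_zero_of_apply_self (congrArg (fun L : TangentSpace I p →L[ℝ] ℝ => L v) h)

theorem eq_zero_of_forall_apply {p : N} {v : TangentSpace I p}
    (h : ∀ W : SField I N, γ p v (W p) = 0) : v = 0 := by
  obtain ⟨W, rfl⟩ := SField.exists_apply_eq p v
  exact hγ.eq_zero_of_apply_self (h W)

theorem isInvertible (p : N) : (γ p).IsInvertible := by
  let c : E →L[ℝ] E →L[ℝ] ℝ := γ p
  have hc : Function.Injective c := by
    rw [injective_iff_map_eq_zero]
    exact fun v hv => hγ.eq_zero_of_apply (p := p) hv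
  have h := isInvertible_of_injective hc
  exact h

theorem apply_sharp (p : N) (α : TangentSpace I p →L[ℝ] ℝ) : γ p (sharpField γ p α) = α :=
  (hγ.isInvertible p).self_apply_inverse α

theorem sharp_apply (p : N) (v : TangentSpace I p) : sharpField γ p (γ p v) = v :=
  (hγ.isInvertible p).inverse_apply_self v

theorem smooth_sharp {α : OneForm I (N := N)} (hα : SmoothOneForm I α) :
    SmoothVField I (fun q => sharpField γ q (α q)) := by
  refine smoothVField_of_nondegenerate (b := γ) (fun X Y hX hY => hγ.smooth ⟨X, hX⟩ ⟨Y, hY⟩)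
    (fun p v hv => hγ.eq_zero_of_apply hv) (fun Y hY => ?_)
  simp only [hγ.apply_sharp]
  exact hα.apply hY

end IsMetricField

/-- The component in `V_+` of an element of the big tangent space. -/
def vPlus (γ : BilinField I (N := N)) (p : N) : TBig I p →L[ℝ] TangentSpace I p :=
  (1 / 2 : ℝ) • (ContinuousLinearMap.fst ℝ _ _ + (sharpField γ p).comp (ContinuousLinearMap.snd ℝ _ _))

/-- The component in `V_-` of an element of the big tangent space. -/
def vMinus (γ : BilinField I (N := N)) (p : N) : TBig I p →L[ℝ] TangentSpace I p :=
  (1 / 2 : ℝ) • (ContinuousLinearMap.fst ℝ _ _ - (sharpField γ p).comp (ContinuousLinearMap.snd ℝ _ _))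

/-- The endomorphism of the big tangent bundle that acts as `J` on `V_+` and as `K` on `V_-`. -/
def bigEndOf (γ : BilinField I (N := N)) (J K : EndField I (N := N)) : BigEnd I (N := N) := fun p =>
  ((J p).comp (vPlus γ p) + (K p).comp (vMinus γ p)).prod
    ((γ p).comp ((J p).comp (vPlus γ p) - (K p).comp (vMinus γ p)))

theorem vPlus_apply (γ : BilinField I (N := N)) (p : N) (x : TBig I p) :
    vPlus γ p x = (1 / 2 : ℝ) • (x.1 + sharpField γ p x.2) := rfl

theorem vMinus_apply (γ : BilinField I (N := N)) (p : N) (x : TBig I p) :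
    vMinus γ p x = (1 / 2 : ℝ) • (x.1 - sharpField γ p x.2) := rfl

theorem bigEndOf_apply (γ : BilinField I (N := N)) (J K : EndField I (N := N)) (p : N)
    (x : TBig I p) : bigEndOf γ J K p x =
      (J p (vPlus γ p x) + K p (vMinus γ p x), γ p (J p (vPlus γ p x) - K p (vMinus γ p x))) := rfl

/-- The element of the big tangent space with given components in `V_+` and `V_-`. -/
def bigMk (γ : BilinField I (N := N)) (p : N) (v w : TangentSpace I p) : TBig I p :=
  (v + w, γ p (v - w))

theorem graphPlus_eq_bigMk (γ : BilinField I (N := N)) (p : N) (v : TangentSpace I p) :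
    graphPlus I γ (fun _ => 0) p v = bigMk γ p v 0 := by
  refine Prod.ext (add_zero v).symm ?_
  simp only [graphPlus, bigMk, sub_zero]
  exact zero_add _

theorem graphMinus_eq_bigMk (γ : BilinField I (N := N)) (p : N) (v : TangentSpace I p) :
    graphMinus I γ (fun _ => 0) p v = bigMk γ p 0 v := by
  refine Prod.ext (zero_add v).symm ?_
  simp only [graphMinus, bigMk, zero_sub, (γ p).map_neg]
  exact zero_sub _

namespace IsMetricField

variable {γ : BilinField I (N := N)} (hγ : IsMetricField γ)
include hγ

theorem vPlus_bigMk (p : N) (v w : TangentSpace I p) : vPlus γ p (bigMk γ p v w) = v := by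
  rw [vPlus_apply]
  simp only [bigMk, hγ.sharp_apply]
  module

theorem vMinus_bigMk (p : N) (v w : TangentSpace I p) : vMinus γ p (bigMk γ p v w) = w := by
  rw [vMinus_apply]
  simp only [bigMk, hγ.sharp_apply]
  module

theorem bigMk_vPlus_vMinus (p : N) (x : TBig I p) :
    bigMk γ p (vPlus γ p x) (vMinus γ p x) = x := by
  refine Prod.ext ?_ ?_
  · simp only [bigMk, vPlus_apply, vMinus_apply]
    module
  · have e : vPlus γ p x - vMinus γ p x = sharpField γ p x.2 := by
      simp only [vPlus_apply, vMinus_apply]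
      module
    simp only [bigMk, e, hγ.apply_sharp]

theorem bigEndOf_bigMk (J K : EndField I (N := N)) (p : N) (v w : TangentSpace I p) :
    bigEndOf γ J K p (bigMk γ p v w) = bigMk γ p (J p v) (K p w) := by
  rw [bigEndOf_apply, hγ.vPlus_bigMk, hγ.vMinus_bigMk]
  rfl

theorem vPlus_bigEndOf (J K : EndField I (N := N)) (p : N) (x : TBig I p) :
    vPlus γ p (bigEndOf γ J K p x) = J p (vPlus γ p x) := by
  rw [bigEndOf_apply]
  exact hγ.vPlus_bigMk p _ _

theorem vMinus_bigEndOf (J K : EndField I (N := N)) (p : N) (x : TBig I p) :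
    vMinus γ p (bigEndOf γ J K p x) = K p (vMinus γ p x) := by
  rw [bigEndOf_apply]
  exact hγ.vMinus_bigMk p _ _

theorem eq_zero_of_vPlus_of_vMinus {p : N} {x : TBig I p} (h₁ : vPlus γ p x = 0)
    (h₂ : vMinus γ p x = 0) : x = 0 := by
  rw [← hγ.bigMk_vPlus_vMinus p x, h₁, h₂]
  refine Prod.ext (add_zero 0) ?_
  simp only [bigMk, sub_zero]
  exact (γ p).map_zero

/-- `V_+` and `V_-` are orthogonal, and the neutral metric restricts to `γ` on `V_+` and to `-γ` on
`V_-`. -/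
theorem neutral_bigMk (p : N) (v w v' w' : TangentSpace I p) :
    neutral I p (bigMk γ p v w) (bigMk γ p v' w') = γ p v v' - γ p w w' := by
  have e (a b c d : TangentSpace I p) : γ p (a - b) (c + d)
      = γ p a c + γ p a d - γ p b c - γ p b d := by
    rw [(γ p (a - b)).map_add, (γ p).map_sub]
    change γ p a c - γ p b c + (γ p a d - γ p b d) = _
    ring
  change (γ p (v - w) (v' + w') + γ p (v' - w') (v + w)) / 2 = _
  rw [e, e, hγ.symm p v' v, hγ.symm p v' w, hγ.symm p w' v, hγ.symm p w' w]
  ring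

theorem exists_bigMk (p : N) (x : TBig I p) : ∃ v w, x = bigMk γ p v w :=
  ⟨_, _, (hγ.bigMk_vPlus_vMinus p x).symm⟩

theorem smoothBigField_bigMk {X Y : VField I (N := N)} (hX : SmoothVField I X)
    (hY : SmoothVField I Y) : SmoothBigField I (fun q => bigMk γ q (X q) (Y q)) :=
  ⟨ContMDiff.add_section hX hY,
    hγ.smooth.smoothOneForm ⟨fun q => X q - Y q, ContMDiff.sub_section hX hY⟩⟩

theorem smooth_vPlus {x : BigField I (N := N)} (h : SmoothBigField I x) :
    SmoothVField I (fun q => vPlus γ q (x q)) :=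
  ContMDiff.const_smul_section (ContMDiff.add_section h.1 (hγ.smooth_sharp h.2))

theorem smooth_vMinus {x : BigField I (N := N)} (h : SmoothBigField I x) :
    SmoothVField I (fun q => vMinus γ q (x q)) :=
  ContMDiff.const_smul_section (ContMDiff.sub_section h.1 (hγ.smooth_sharp h.2))

theorem smooth_bigEndOf {J K : EndField I (N := N)}
    (hJ : ∀ X : SField I N, SmoothVField I (fun q => J q (X q)))
    (hK : ∀ X : SField I N, SmoothVField I (fun q => K q (X q))) :
    SmoothBigEnd I (bigEndOf γ J K) := fun _ h =>
  hγ.smoothBigField_bigMk (hJ ⟨_, hγ.smooth_vPlus h⟩) (hK ⟨_, hγ.smooth_vMinus h⟩)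

/-- The musical endomorphism of the generalized Riemannian metric that corresponds to
`(γ, 0)`. -/
theorem isGenMetricOf :
    IsGenMetricOf I γ (fun _ => 0) (bigEndOf γ (fun p => ContinuousLinearMap.id ℝ (TangentSpace I p))
      (fun p => -ContinuousLinearMap.id ℝ (TangentSpace I p))) where
  smooth := hγ.smooth_bigEndOf (fun X => X.smooth) (fun X => (-X).smooth)
  invol p x := by
    obtain ⟨v, w, rfl⟩ := hγ.exists_bigMk p x
    rw [hγ.bigEndOf_bigMk, hγ.bigEndOf_bigMk]
    exact congrArg (bigMk γ p v) (neg_neg w)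
  isometry p x y := by
    obtain ⟨v, w, rfl⟩ := hγ.exists_bigMk p x
    obtain ⟨v', w', rfl⟩ := hγ.exists_bigMk p y
    rw [hγ.bigEndOf_bigMk, hγ.bigEndOf_bigMk, hγ.neutral_bigMk, hγ.neutral_bigMk]
    have e : γ p (-w) (-w') = γ p w w' := by
      rw [(γ p (-w)).map_neg, (γ p).map_neg]; exact neg_neg _
    change γ p v v' - γ p (-w) (-w') = _
    rw [e]
  pos p x hx := by
    obtain ⟨v, w, rfl⟩ := hγ.exists_bigMk p x
    rw [hγ.bigEndOf_bigMk, hγ.neutral_bigMk]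
    have e : γ p (-w) w = -γ p w w := by rw [(γ p).map_neg]; rfl
    change 0 < 2 * (γ p v v - γ p (-w) w)
    rw [e]
    have nn (u : TangentSpace I p) : 0 ≤ γ p u u := by
      by_cases hu : u = 0
      · rw [hu, (γ p 0).map_zero]
      · exact (hγ.pos p u hu).le
    have hv := nn v
    have hw := nn w
    by_cases h0 : v = 0
    · have hw0 : w ≠ 0 := by
        rintro rfl
        refine hx ?_
        rw [h0]
        refine Prod.ext (add_zero 0) ?_
        simp only [bigMk, sub_zero]
        exact (γ p).map_zero
      linarith [hγ.pos p w hw0]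
    · linarith [hγ.pos p v h0]
  eigen_plus p v := by
    rw [graphPlus_eq_bigMk, hγ.bigEndOf_bigMk]
    exact congrArg (bigMk γ p v) (neg_zero)
  eigen_minus p v := by
    rw [graphMinus_eq_bigMk, hγ.bigEndOf_bigMk]
    refine Prod.ext ?_ ?_
    · change (0 : TangentSpace I p) + -v = -(0 + v)
      rw [zero_add, zero_add]
    · change γ p (0 - -v) = -γ p (0 - v)
      rw [← (γ p).map_neg, zero_sub, zero_sub]

theorem two_mul_vPlus (p : N) (x : TBig I p) (v : TangentSpace I p) :
    2 * γ p (vPlus γ p x) v = γ p x.1 v + x.2 v := by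
  have e : γ p (vPlus γ p x) = (1 / 2 : ℝ) • (γ p x.1 + x.2) := by
    rw [vPlus_apply, (γ p).map_smul, (γ p).map_add, hγ.apply_sharp]
  rw [e]
  change 2 * ((1 / 2 : ℝ) * (γ p x.1 v + x.2 v)) = _
  ring

theorem two_mul_vMinus (p : N) (x : TBig I p) (v : TangentSpace I p) :
    2 * γ p (vMinus γ p x) v = γ p x.1 v - x.2 v := by
  have e : γ p (vMinus γ p x) = (1 / 2 : ℝ) • (γ p x.1 - x.2) := by
    rw [vMinus_apply, (γ p).map_smul, (γ p).map_sub, hγ.apply_sharp]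
  rw [e]
  change 2 * ((1 / 2 : ℝ) * (γ p x.1 v - x.2 v)) = _
  ring

end IsMetricField

/-- The section of the big tangent bundle with given components in `V_+` and `V_-`. -/
def bigSection (γ : BilinField I (N := N)) (X X' : SField I N) : BigField I (N := N) :=
  fun q => bigMk γ q (X q) (X' q)

theorem two_mul_courant_bigSection {γ : BilinField I (N := N)} (hγ : SmoothOnFields γ)
    (X X' Y Y' W : SField I N) (p : N) :
    2 * (courant I (bigSection γ X X') (bigSection γ Y Y') p).2 (W p) =
      courantTwo (pairTwo γ hγ X - pairTwo γ hγ X') (pairTwo γ hγ Y - pairTwo γ hγ Y')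
        (X + X') (Y + Y') W p := by
  rw [← map_sub, ← map_sub]
  exact two_mul_courant_snd (hγ.smoothOneForm (X - X')) (hγ.smoothOneForm (Y - Y')) (X + X')
    (Y + Y') W p

theorem pairTwo_symm {γ : BilinField I (N := N)} (hγ : IsMetricField γ) (X Y : SField I N) :
    pairTwo γ hγ.smooth X Y = pairTwo γ hγ.smooth Y X := by
  ext p; exact hγ.symm p _ _

theorem four_mul_vPlus_courant {γ : BilinField I (N := N)} (hγ : IsMetricField γ)
    (X X' Y Y' W : SField I N) (p : N) :
    4 * γ p (vPlus γ p (courant I (bigSection γ X X') (bigSection γ Y Y') p)) (W p) =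
      courantPlus (pairTwo γ hγ.smooth) X X' Y Y' W p := by
  have h := two_mul_courant_bigSection hγ.smooth X X' Y Y' W p
  have h' := hγ.two_mul_vPlus p (courant I (bigSection γ X X') (bigSection γ Y Y') p) (W p)
  have e : (courant I (bigSection γ X X') (bigSection γ Y Y') p).1 = ⁅X + X', Y + Y'⁆ p := rfl
  rw [← courantPlus_eq _ (pairTwo_symm hγ)]
  simp only [ContMDiffMap.coe_add, ContMDiffMap.coe_mul, Pi.add_apply, Pi.mul_apply, SFun.two_apply]
  rw [← h]
  have e' : pairTwo γ hγ.smooth ⁅X + X', Y + Y'⁆ W p = γ p (⁅X + X', Y + Y'⁆ p) (W p) := rfl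
  rw [e', ← e]
  linarith

theorem four_mul_vMinus_courant {γ : BilinField I (N := N)} (hγ : IsMetricField γ)
    (X X' Y Y' W : SField I N) (p : N) :
    4 * γ p (vMinus γ p (courant I (bigSection γ X X') (bigSection γ Y Y') p)) (W p) =
      -courantPlus (-pairTwo γ hγ.smooth) X' X Y' Y W p := by
  have h := two_mul_courant_bigSection hγ.smooth X X' Y Y' W p
  have h' := hγ.two_mul_vMinus p (courant I (bigSection γ X X') (bigSection γ Y Y') p) (W p)
  have e : (courant I (bigSection γ X X') (bigSection γ Y Y') p).1 = ⁅X + X', Y + Y'⁆ p := rfl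
  -- Replacing `γ` by `-γ` interchanges `V_+` and `V_-` without changing the section, so the primed
  -- fields come first.
  rw [← courantPlus_eq (-pairTwo γ hγ.smooth) (fun X Y => congrArg Neg.neg (pairTwo_symm hγ X Y))]
  have e₁ : (-pairTwo γ hγ.smooth) X' - (-pairTwo γ hγ.smooth) X
    = pairTwo γ hγ.smooth X - pairTwo γ hγ.smooth X' := by
      simp only [AddMonoidHom.neg_apply]; abel
  have e₂ : (-pairTwo γ hγ.smooth) Y' - (-pairTwo γ hγ.smooth) Y
    = pairTwo γ hγ.smooth Y - pairTwo γ hγ.smooth Y' := by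
      simp only [AddMonoidHom.neg_apply]; abel
  rw [e₁, e₂, add_comm X' X, add_comm Y' Y]
  simp only [ContMDiffMap.coe_add, ContMDiffMap.coe_mul, Pi.add_apply, Pi.mul_apply, SFun.two_apply]
  rw [← h]
  have e' : (-pairTwo γ hγ.smooth) ⁅X + X', Y + Y'⁆ W p = -γ p (⁅X + X', Y + Y'⁆ p) (W p) := rfl
  rw [e', ← e]
  linarith

/-- Kähler structures with metric `γ`. -/
structure IsKahlerField (γ : BilinField I (N := N)) (hγ : SmoothOnFields γ)
    (J : EndField I (N := N)) : Prop where
  smooth : ∀ X : SField I N, SmoothVField I (fun q => J q (X q))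
  sq : ∀ (p : N) (v : TangentSpace I p), J p (J p v) = -v
  skew : ∀ (p : N) (v w : TangentSpace I p), γ p (J p v) w = -γ p v (J p w)
  integrable : NijenhuisVanishes I J
  closed : ∀ X Y W : SField I N,
    dTwo ((pairTwo γ hγ).comp (endMap J smooth)) X Y W = 0

theorem IsKahlerField.isKahlerPair {γ : BilinField I (N := N)} {hγ : SmoothOnFields γ}
    {J : EndField I (N := N)} (h : IsKahlerField γ hγ J) :
    IsKahlerPair (pairTwo γ hγ) (endMap J h.smooth) where
  sq X := by ext p; exact h.sq p (X p)
  skew X Y := by ext p; exact h.skew p (X p) (Y p)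
  integrable X Y := by ext p; exact h.integrable _ _ X.smooth Y.smooth p
  closed := h.closed

theorem IsKahlerField.neg {γ : BilinField I (N := N)} {hγ : SmoothOnFields γ}
    {J : EndField I (N := N)} (h : IsKahlerField γ hγ J) :
    IsKahlerField γ hγ (fun p => -J p) where
  smooth X := (-(endMap J h.smooth X)).smooth
  sq p v := by
    change -J p (-J p v) = -v
    rw [(J p).map_neg, neg_neg, h.sq]
  skew p v w := by
    change γ p (-J p v) w = -γ p v (-J p w)
    rw [(γ p).map_neg, (γ p v).map_neg, ← h.skew]
    rfl
  integrable X Y hX hY p := by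
    have e := h.isKahlerPair.neg_right.integrable ⟨X, hX⟩ ⟨Y, hY⟩
    exact congrArg (fun Z : SField I N => Z p) e
  closed := h.isKahlerPair.neg_right.closed

theorem IsKahlerField.apply_torsion {γ : BilinField I (N := N)} {hγ : SmoothOnFields γ}
    {J : EndField I (N := N)} (h : IsKahlerField γ hγ J) (p : N) (a b c d w : TangentSpace I p) :
    γ p (a - J p b - J p c + J p (J p d)) w
      = γ p a w + γ p b (J p w) + γ p c (J p w) - γ p d w := by
  rw [(γ p).map_add, (γ p).map_sub, (γ p).map_sub, h.sq, (γ p).map_neg]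
  change γ p a w - γ p (J p b) w - γ p (J p c) w + -γ p d w = _
  rw [h.skew, h.skew]
  ring

theorem isGenComplex_bigEndOf {γ : BilinField I (N := N)} (hγ : IsMetricField γ)
    {J K : EndField I (N := N)} (hJ : IsKahlerField γ hγ.smooth J)
    (hK : IsKahlerField γ hγ.smooth K) : IsGenComplex I (bigEndOf γ J K) where
  smooth := hγ.smooth_bigEndOf hJ.smooth hK.smooth
  skew p x y := by
    obtain ⟨v, w, rfl⟩ := hγ.exists_bigMk p x
    obtain ⟨v', w', rfl⟩ := hγ.exists_bigMk p y
    rw [hγ.bigEndOf_bigMk, hγ.bigEndOf_bigMk, hγ.neutral_bigMk, hγ.neutral_bigMk, hJ.skew, hK.skew]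
    ring
  sq p x := by
    obtain ⟨v, w, rfl⟩ := hγ.exists_bigMk p x
    rw [hγ.bigEndOf_bigMk, hγ.bigEndOf_bigMk, hJ.sq, hK.sq]
    refine Prod.ext ?_ ?_
    · change -v + -w = -(v + w)
      rw [neg_add]
    · change γ p (-v - -w) = -γ p (v - w)
      rw [← (γ p).map_neg]
      congr 1
      abel
  torsion 𝒳 𝒴 h𝒳 h𝒴 p := by
    let X : SField I N := ⟨_, hγ.smooth_vPlus h𝒳⟩
    let X' : SField I N := ⟨_, hγ.smooth_vMinus h𝒳⟩
    let Y : SField I N := ⟨_, hγ.smooth_vPlus h𝒴⟩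
    let Y' : SField I N := ⟨_, hγ.smooth_vMinus h𝒴⟩
    have e𝒳 : 𝒳 = bigSection γ X X' := funext fun q => (hγ.bigMk_vPlus_vMinus q _).symm
    have e𝒴 : 𝒴 = bigSection γ Y Y' := funext fun q => (hγ.bigMk_vPlus_vMinus q _).symm
    have e (X X' : SField I N) : (fun q => bigEndOf γ J K q (bigSection γ X X' q))
        = bigSection γ (endMap J hJ.smooth X) (endMap K hK.smooth X') :=
      funext fun q => hγ.bigEndOf_bigMk J K q (X q) (X' q)
    rw [e𝒳, e𝒴]
    simp only [courantNijenhuis, e]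
    have two : ∀ c : SFun I N, 2 * c = 0 → c = 0 := fun c hc =>
      SFun.eq_zero_of_nsmul 2 two_ne_zero c (by exact_mod_cast hc)
    have kp := courantPlus_torsion _ (pairTwo_symm hγ) two hJ.isKahlerPair hK.isKahlerPair X X' Y Y'
    have km := courantPlus_torsion _ (fun X Y => congrArg Neg.neg (pairTwo_symm hγ X Y)) two
      hK.isKahlerPair.neg hJ.isKahlerPair.neg X' X Y' Y
    have fp (X X' Y Y' : SField I N) := four_mul_vPlus_courant hγ X X' Y Y'
    have fm (X X' Y Y' : SField I N) := four_mul_vMinus_courant hγ X X' Y Y'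
    -- The two components of the torsion are treated apart. The `V_-` component is the `V_+`
    -- computation for `-γ` with `J` and `K` interchanged.
    refine hγ.eq_zero_of_vPlus_of_vMinus ?_ ?_
    · rw [(vPlus γ p).map_add, (vPlus γ p).map_sub, (vPlus γ p).map_sub, hγ.vPlus_bigEndOf,
        hγ.vPlus_bigEndOf, hγ.vPlus_bigEndOf, hγ.vPlus_bigEndOf]
      refine hγ.eq_zero_of_forall_apply fun W => ?_
      rw [hJ.apply_torsion]
      have h₁ := fp (endMap J hJ.smooth X) (endMap K hK.smooth X') (endMap J hJ.smooth Y)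
        (endMap K hK.smooth Y') W p
      have h₂ := fp X X' (endMap J hJ.smooth Y) (endMap K hK.smooth Y') (endMap J hJ.smooth W) p
      have h₃ := fp (endMap J hJ.smooth X) (endMap K hK.smooth X') Y Y' (endMap J hJ.smooth W) p
      have h₄ := fp X X' Y Y' W p
      have k := congrArg (fun f : SFun I N => f p) (kp W)
      simp only [ContMDiffMap.coe_add, ContMDiffMap.coe_sub, Pi.add_apply, Pi.sub_apply] at k
      rw [← h₁, ← h₂, ← h₃, ← h₄] at k
      change _ = (0 : ℝ) at k
      have e₁ : endMap J hJ.smooth W p = J p (W p) := rfl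
      rw [e₁] at k
      linarith
    · rw [(vMinus γ p).map_add, (vMinus γ p).map_sub, (vMinus γ p).map_sub, hγ.vMinus_bigEndOf,
        hγ.vMinus_bigEndOf, hγ.vMinus_bigEndOf, hγ.vMinus_bigEndOf]
      refine hγ.eq_zero_of_forall_apply fun W => ?_
      rw [hK.apply_torsion]
      have h₁ := fm (endMap J hJ.smooth X) (endMap K hK.smooth X') (endMap J hJ.smooth Y)
        (endMap K hK.smooth Y') W p
      have h₂ := fm X X' (endMap J hJ.smooth Y) (endMap K hK.smooth Y') (endMap K hK.smooth W) p
      have h₃ := fm (endMap J hJ.smooth X) (endMap K hK.smooth X') Y Y' (endMap K hK.smooth W) p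
      have h₄ := fm X X' Y Y' W p
      have k := congrArg (fun f : SFun I N => f p) (km W)
      simp only [ContMDiffMap.coe_add, ContMDiffMap.coe_sub, Pi.add_apply, Pi.sub_apply] at k
      rw [← neg_eq_iff_eq_neg] at h₁ h₂ h₃ h₄
      rw [← h₁, ← h₂, ← h₃, ← h₄] at k
      change _ = (0 : ℝ) at k
      have e₁ : endMap K hK.smooth W p = K p (W p) := rfl
      rw [e₁] at k
      linarith

/-- A pair of Kähler structures with the same metric defines a generalized Kähler structure. -/
theorem isGenKahler_bigEndOf {γ : BilinField I (N := N)} (hγ : IsMetricField γ)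
    {J K : EndField I (N := N)} (hJ : IsKahlerField γ hγ.smooth J)
    (hK : IsKahlerField γ hγ.smooth K) :
    IsGenKahler I (bigEndOf γ (fun p => ContinuousLinearMap.id ℝ (TangentSpace I p))
      (fun p => -ContinuousLinearMap.id ℝ (TangentSpace I p))) (bigEndOf γ J K) where
  metric := hγ.isGenMetricOf.toIsGenMetric
  compatible p x := by
    obtain ⟨v, w, rfl⟩ := hγ.exists_bigMk p x
    rw [hγ.bigEndOf_bigMk, hγ.bigEndOf_bigMk, hγ.bigEndOf_bigMk, hγ.bigEndOf_bigMk]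
    exact congrArg (bigMk γ p (J p v)) ((K p).map_neg w).symm
  integrable := isGenComplex_bigEndOf hγ hJ hK
  integrable_compl := by
    have e : (fun p => (bigEndOf γ (fun p => ContinuousLinearMap.id ℝ (TangentSpace I p))
        (fun p => -ContinuousLinearMap.id ℝ (TangentSpace I p)) p).comp (bigEndOf γ J K p))
        = bigEndOf γ J (fun p => -K p) := by
      funext p
      refine ContinuousLinearMap.ext fun x => ?_
      obtain ⟨v, w, rfl⟩ := hγ.exists_bigMk p x
      rw [ContinuousLinearMap.comp_apply, hγ.bigEndOf_bigMk, hγ.bigEndOf_bigMk, hγ.bigEndOf_bigMk]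
      rfl
    rw [e]
    exact isGenComplex_bigEndOf hγ hJ hK.neg

theorem isInducedPair_bigEndOf {γ : BilinField I (N := N)} (hγ : IsMetricField γ)
    (J K : EndField I (N := N)) : IsInducedPair I γ (fun _ => 0) (bigEndOf γ J K) J K where
  plus p v := by
    rw [graphPlus_eq_bigMk, graphPlus_eq_bigMk, hγ.bigEndOf_bigMk, (K p).map_zero]
  minus p v := by
    rw [graphMinus_eq_bigMk, graphMinus_eq_bigMk, hγ.bigEndOf_bigMk, (J p).map_zero]

end
end GenSasaki
end

/-! ### Tensor calculus on `M × ℝ` -/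

noncomputable section
namespace GenSasaki

open Bundle Set
open scoped Topology

set_option linter.unusedSectionVars false
section
variable {E : Type*} [NormedAddCommGroup E] [NormedSpace ℝ E] [FiniteDimensional ℝ E]
  {H : Type*} [TopologicalSpace H] {I : ModelWithCorners ℝ E H} [I.Boundaryless]
  {M : Type*} [TopologicalSpace M] [T2Space M] [ChartedSpace H M] [IsManifold I ∞ M]

theorem prM_apply (q : M × ℝ) (v : TangentSpace (I.prod 𝓘(ℝ, ℝ)) q) : prM I q v = Prod.fst (α := E) (β := ℝ) v :=
  congrArg (fun L : E × ℝ →L[ℝ] E => L v) mfderiv_fst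

theorem dt_apply (q : M × ℝ) (v : TangentSpace (I.prod 𝓘(ℝ, ℝ)) q) : dt I q v = Prod.snd (α := E) (β := ℝ) v :=
  congrArg (fun L : E × ℝ →L[ℝ] ℝ => L v) mfderiv_snd

/-- The tangent vector of `M × ℝ` with components `v` and `s`. -/
def prodVec (q : M × ℝ) (v : TangentSpace I q.1) (s : ℝ) : TangentSpace (I.prod 𝓘(ℝ, ℝ)) q :=
  ((v, s) : E × ℝ)

theorem exists_prodVec (q : M × ℝ) (v : TangentSpace (I.prod 𝓘(ℝ, ℝ)) q) :
    ∃ (w : TangentSpace I q.1) (s : ℝ), prodVec q w s = v :=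
  ⟨Prod.fst (α := E) (β := ℝ) v, Prod.snd (α := E) (β := ℝ) v, rfl⟩

theorem prM_prodVec (q : M × ℝ) (v : TangentSpace I q.1) (s : ℝ) : prM I q (prodVec q v s) = v :=
  prM_apply q _

theorem dt_prodVec (q : M × ℝ) (v : TangentSpace I q.1) (s : ℝ) : dt I q (prodVec q v s) = s :=
  dt_apply q _

theorem prodVec_inj {q : M × ℝ} {v w : TangentSpace I q.1} {s r : ℝ}
    (h : prodVec q v s = prodVec q w r) : v = w ∧ s = r :=
  ⟨congrArg (Prod.fst (α := E) (β := ℝ)) h, congrArg (Prod.snd (α := E) (β := ℝ)) h⟩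

theorem inclM_apply (q : M × ℝ) (v : TangentSpace I q.1) : inclM I q v = prodVec q v 0 :=
  congrArg (fun L : E →L[ℝ] E × ℝ => L v) mfderiv_prod_left

theorem ddt_eq (q : M × ℝ) : ddt I q = prodVec q 0 1 :=
  congrArg (fun L : ℝ →L[ℝ] E × ℝ => L 1) mfderiv_prod_right

theorem adaptedJ_apply (F : EndField I (N := M)) (Z : VField I (N := M)) (ξ : OneForm I (N := M))
    (q : M × ℝ) (v : TangentSpace I q.1) (s : ℝ) :
    adaptedJ I F Z ξ q (prodVec q v s) = prodVec q (F q.1 v + s • Z q.1) (-ξ q.1 v) := by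
  have h : adaptedJ I F Z ξ q (prodVec q v s) =
      (inclM I q (F q.1 (prM I q (prodVec q v s)))
        + dt I q (prodVec q v s) • inclM I q (Z q.1)
        - ξ q.1 (prM I q (prodVec q v s)) • ddt I q) := rfl
  rw [h, prM_prodVec, dt_prodVec, inclM_apply, inclM_apply, ddt_eq]
  refine Prod.ext (α := E) (β := ℝ) ?_ ?_
  · have e (a : E) (c : ℝ) : a - c • (0 : E) = a := by rw [smul_zero, sub_zero]
    exact e (F q.1 v + s • Z q.1) (ξ q.1 v)
  · change (0 + s • 0 - ξ q.1 v • 1 : ℝ) = -ξ q.1 v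
    simp

theorem coneMetric_apply (γ : BilinField I (N := M)) (q : M × ℝ)
    (v w : TangentSpace I q.1) (s r : ℝ) :
    coneMetric I γ q (prodVec q v s) (prodVec q w r) = Real.exp q.2 * (γ q.1 v w + s * r) := by
  have h : coneMetric I γ q (prodVec q v s) (prodVec q w r) =
    Real.exp q.2 * (γ q.1 (prM I q (prodVec q v s)) (prM I q (prodVec q w r)) +
      dt I q (prodVec q v s) * dt I q (prodVec q w r)) := rfl
  rw [h, prM_prodVec, prM_prodVec, dt_prodVec, dt_prodVec]

theorem coneForm_apply (ψ : BilinField I (N := M)) (κ : OneForm I (N := M)) (q : M × ℝ)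
    (v w : TangentSpace I q.1) (s r : ℝ) :
    coneForm I ψ κ q (prodVec q v s) (prodVec q w r) =
      Real.exp q.2 * (ψ q.1 v w + κ q.1 v * r - s * κ q.1 w) := by
  have h : coneForm I ψ κ q (prodVec q v s) (prodVec q w r) =
    Real.exp q.2 * (ψ q.1 (prM I q (prodVec q v s)) (prM I q (prodVec q w r)) +
      κ q.1 (prM I q (prodVec q v s)) * dt I q (prodVec q w r)
      - dt I q (prodVec q v s) * κ q.1 (prM I q (prodVec q w r))) := rfl
  rw [h, prM_prodVec, prM_prodVec, dt_prodVec, dt_prodVec]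

theorem coneForm_zero : coneForm I (fun _ : M => 0) (fun _ => 0) = fun _ => 0 := by
  funext q
  refine ContinuousLinearMap.ext fun v => ContinuousLinearMap.ext fun w => ?_
  obtain ⟨v, s, rfl⟩ := exists_prodVec q v
  obtain ⟨w, r, rfl⟩ := exists_prodVec q w
  refine (coneForm_apply _ _ q v w s r).trans ?_
  change Real.exp q.2 * (0 + 0 * r - s * 0) = 0
  ring

/-- Vector fields on `M × ℝ` are smooth if their components are. -/
theorem smoothVField_prod {V : VField (I.prod 𝓘(ℝ, ℝ)) (N := M × ℝ)}
    (h₁ : ContMDiff (I.prod 𝓘(ℝ, ℝ)) I.tangent ∞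
      (fun q : M × ℝ => (⟨q.1, prM I q (V q)⟩ : TangentBundle I M)))
    (h₂ : ContMDiff (I.prod 𝓘(ℝ, ℝ)) 𝓘(ℝ, ℝ) ∞ (fun q : M × ℝ => dt I q (V q))) :
    SmoothVField (I.prod 𝓘(ℝ, ℝ)) V := by
  have h₃ : ContMDiff (I.prod 𝓘(ℝ, ℝ)) 𝓘(ℝ, ℝ).tangent ∞
      (fun q : M × ℝ => (⟨q.2, dt I q (V q)⟩ : TangentBundle 𝓘(ℝ, ℝ) ℝ)) := by
    intro q
    rw [contMDiffAt_totalSpace]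
    refine ⟨contMDiff_snd q, ?_⟩
    simpa using h₂ q
  have := (contMDiff_equivTangentBundleProd_symm (I := I) (M := M) (I' := 𝓘(ℝ, ℝ)) (M' := ℝ) (n := ∞)).comp
    (h₁.prodMk h₃)
  refine this.congr fun q => ?_
  refine congrArg (Bundle.TotalSpace.mk q) ?_
  refine Prod.ext (α := E) (β := ℝ) ?_ ?_
  · exact (prM_apply q (V q)).symm
  · exact (dt_apply q (V q)).symm

theorem SmoothVField.prM {V : VField (I.prod 𝓘(ℝ, ℝ)) (N := M × ℝ)}
    (h : SmoothVField (I.prod 𝓘(ℝ, ℝ)) V) : ContMDiff (I.prod 𝓘(ℝ, ℝ)) I.tangent ∞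
      (fun q : M × ℝ => (⟨q.1, prM I q (V q)⟩ : TangentBundle I M)) :=
  (contMDiff_fst.contMDiff_tangentMap (n := ∞) (by simp)).comp h

theorem SmoothVField.dt {V : VField (I.prod 𝓘(ℝ, ℝ)) (N := M × ℝ)}
    (h : SmoothVField (I.prod 𝓘(ℝ, ℝ)) V) :
    ContMDiff (I.prod 𝓘(ℝ, ℝ)) 𝓘(ℝ, ℝ) ∞ (fun q : M × ℝ => dt I q (V q)) :=
  contMDiff_dFun_apply contMDiff_snd h

theorem SmoothOneForm.apply_comp {α : OneForm I (N := M)} (hα : SmoothOneForm I α)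
    {V : Π q : M × ℝ, TangentSpace I q.1} (hV : ContMDiff (I.prod 𝓘(ℝ, ℝ)) I.tangent ∞
      (fun q : M × ℝ => (⟨q.1, V q⟩ : TangentBundle I M))) :
    ContMDiff (I.prod 𝓘(ℝ, ℝ)) 𝓘(ℝ, ℝ) ∞ (fun q => α q.1 (V q)) := by
  intro p
  have := ContMDiffAt.clm_bundle_apply (F₂ := ℝ) (E₂ := Bundle.Trivial M ℝ) (n := ∞)
    (b := fun q : M × ℝ => q.1) ((hα p.1).comp p contMDiffAt_fst) (hV p)
  rw [contMDiffAt_totalSpace] at this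
  exact this.2

theorem SmoothEndField.apply_comp {F : EndField I (N := M)} (hF : SmoothEndField I F)
    {V : Π q : M × ℝ, TangentSpace I q.1} (hV : ContMDiff (I.prod 𝓘(ℝ, ℝ)) I.tangent ∞
      (fun q : M × ℝ => (⟨q.1, V q⟩ : TangentBundle I M))) :
    ContMDiff (I.prod 𝓘(ℝ, ℝ)) I.tangent ∞
      (fun q : M × ℝ => (⟨q.1, F q.1 (V q)⟩ : TangentBundle I M)) :=
  fun p => ContMDiffAt.clm_bundle_apply (n := ∞) (b := fun q : M × ℝ => q.1)
    ((hF p.1).comp p contMDiffAt_fst) (hV p)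

theorem SmoothBilinField.apply_comp {b : BilinField I (N := M)} (hb : SmoothBilinField I b)
    {V W : Π q : M × ℝ, TangentSpace I q.1} (hV : ContMDiff (I.prod 𝓘(ℝ, ℝ)) I.tangent ∞
      (fun q : M × ℝ => (⟨q.1, V q⟩ : TangentBundle I M)))
    (hW : ContMDiff (I.prod 𝓘(ℝ, ℝ)) I.tangent ∞
      (fun q : M × ℝ => (⟨q.1, W q⟩ : TangentBundle I M))) :
    ContMDiff (I.prod 𝓘(ℝ, ℝ)) 𝓘(ℝ, ℝ) ∞ (fun q => b q.1 (V q) (W q)) := by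
  intro p
  have := ContMDiffAt.clm_bundle_apply₂ (F₃ := ℝ) (E₃ := Bundle.Trivial M ℝ) (n := ∞)
    (b := fun q : M × ℝ => q.1) ((hb p.1).comp p contMDiffAt_fst) (hV p) (hW p)
  rw [contMDiffAt_totalSpace] at this
  exact this.2

theorem contMDiff_exp_snd :
    ContMDiff (I.prod 𝓘(ℝ, ℝ)) 𝓘(ℝ, ℝ) ∞ (fun q : M × ℝ => Real.exp q.2) :=
  Real.contDiff_exp.contMDiff.comp contMDiff_snd

theorem smoothOnFields_coneMetric {γ : BilinField I (N := M)} (hγ : SmoothBilinField I γ) :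
    SmoothOnFields (coneMetric I γ) := fun V W =>
  contMDiff_exp_snd.mul ((hγ.apply_comp V.smooth.prM W.smooth.prM).add
    (V.smooth.dt.mul W.smooth.dt))

theorem smoothOnFields_coneForm {ψ : BilinField I (N := M)} (hψ : SmoothBilinField I ψ)
    {κ : OneForm I (N := M)} (hκ : SmoothOneForm I κ) :
    SmoothOnFields (coneForm I ψ κ) := fun V W =>
  contMDiff_exp_snd.mul (((hψ.apply_comp V.smooth.prM W.smooth.prM).add
    ((hκ.apply_comp V.smooth.prM).mul W.smooth.dt)).sub
      (V.smooth.dt.mul (hκ.apply_comp W.smooth.prM)))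

/-- The vector field on `M × ℝ` with components `X` and `f`. -/
def liftField (X : SField I M) (f : SFun I M) : SField (I.prod 𝓘(ℝ, ℝ)) (M × ℝ) :=
  ⟨fun q => prodVec q (X q.1) (f q.1), smoothVField_prod
    ((X.smooth.comp contMDiff_fst).congr fun q => by rw [prM_prodVec]; rfl)
    ((f.contMDiff.comp contMDiff_fst).congr fun q => by rw [dt_prodVec]; rfl)⟩

theorem liftField_apply (X : SField I M) (f : SFun I M) (q : M × ℝ) :
    liftField X f q = prodVec q (X q.1) (f q.1) := rfl

theorem liftField_inj {X Y : SField I M} {f g : SFun I M} (h : liftField X f = liftField Y g) :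
    X = Y ∧ f = g := by
  have e (p : M) := prodVec_inj (congrArg (fun V : SField (I.prod 𝓘(ℝ, ℝ)) (M × ℝ) => V (p, 0)) h)
  exact ⟨by ext p; exact (e p).1, by ext p; exact (e p).2⟩

/-- Tangent vectors are separated by smooth functions. -/
theorem eq_of_forall_dFun {p : M} {v w : TangentSpace I p}
    (h : ∀ f : SFun I M, dFun I f p v = dFun I f p w) : v = w := by
  refine (SeparatingDual.eq_iff_forall_dual_eq (R := ℝ) (V := E)).2 fun ℓ => ?_
  obtain ⟨f⟩ : Nonempty (SmoothBumpFunction I p) := inferInstance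
  have hs : ContMDiff I 𝓘(ℝ, ℝ) ∞ (fun q => f q • ℓ (extChartAt I p q)) := by
    refine f.contMDiff_smul ?_
    exact ℓ.contDiff.contMDiff.comp_contMDiffOn (contMDiffOn_extChartAt (n := ∞))
  -- Cut-off linear functionals of the chart are global functions with differential `ℓ` at `p`.
  have e : (fun q => f q • ℓ (extChartAt I p q)) =ᶠ[𝓝 p] fun q => ℓ (extChartAt I p q) := by
    filter_upwards [f.eventuallyEq_one] with q hq
    simp [hq]
  have h₁ := h ⟨_, hs⟩
  have key (v : TangentSpace I p) : dFun I (fun q => f q • ℓ (extChartAt I p q)) p v = ℓ (v : E) := by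
    unfold dFun
    rw [e.mfderiv_eq]
    have hc := mdifferentiableAt_extChartAt (I := I) (mem_chart_source H p)
    have hℓ : MDifferentiableAt 𝓘(ℝ, E) 𝓘(ℝ, ℝ) ℓ (extChartAt I p p) :=
      ℓ.differentiableAt.mdifferentiableAt
    have h₂ := mfderiv_comp p hℓ hc
    refine (congrArg (fun L : E →L[ℝ] ℝ => L v) h₂).trans ?_
    change mfderiv 𝓘(ℝ, E) 𝓘(ℝ, ℝ) ℓ (extChartAt I p p)
      (mfderiv I 𝓘(ℝ, E) (extChartAt I p) p v) = ℓ (v : E)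
    rw [mfderiv_eq_fderiv, ℓ.fderiv]
    exact congrArg ℓ (mfderiv_extChartAt_self_apply p v)
  exact (key v).symm.trans (h₁.trans (key w))

theorem dFun_comp_fst (f : SFun I M) (q : M × ℝ) (v : TangentSpace (I.prod 𝓘(ℝ, ℝ)) q) :
    dFun (I.prod 𝓘(ℝ, ℝ)) (fun q : M × ℝ => f q.1) q v = dFun I f q.1 (prM I q v) :=
  congrArg (fun L : E × ℝ →L[ℝ] ℝ => L v) (mfderiv_comp q (f.contMDiff.mdifferentiable (by simp) q.1)
    mdifferentiableAt_fst)

/-- Lifted fields have `t`-independent components, so `∂/∂t` contributes nothing. The bracket is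
identified by its action on functions of `M` and on `t`, which detect its two components. -/
theorem lie_liftField (X Y : SField I M) (f g : SFun I M) :
    ⁅liftField X f, liftField Y g⁆ = liftField ⁅X, Y⁆ (⁅X, g⁆ - ⁅Y, f⁆) := by
  ext q
  have hs {h : M × ℝ → ℝ} (hh : ContMDiff (I.prod 𝓘(ℝ, ℝ)) 𝓘(ℝ, ℝ) ∞ h) :=
    dFun_mlieBracket hh (liftField X f).smooth (liftField Y g).smooth q
  obtain ⟨v, s, hv⟩ := exists_prodVec q (⁅liftField X f, liftField Y g⁆ q)
  rw [← hv, liftField_apply]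
  have lift_fst (h : SFun I M) (X : SField I M) (f : SFun I M) :
      (fun q => dFun (I.prod 𝓘(ℝ, ℝ)) (fun q : M × ℝ => h q.1) q (liftField X f q)) =
        fun q : M × ℝ => (⁅X, h⁆ : SFun I M) q.1 := by
    funext q
    rw [dFun_comp_fst, liftField_apply, prM_prodVec, lie_sFun_apply]
  have lift_snd (X : SField I M) (f : SFun I M) :
      (fun q : M × ℝ => dFun (I.prod 𝓘(ℝ, ℝ)) Prod.snd q (liftField X f q)) =
        fun q : M × ℝ => f q.1 := by
    funext q
    exact dt_prodVec q _ _
  have e₁ : v = (⁅X, Y⁆ : SField I M) q.1 := by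
    refine eq_of_forall_dFun fun h => ?_
    have e := hs (h.contMDiff.comp contMDiff_fst)
    change dFun (I.prod 𝓘(ℝ, ℝ)) (fun q : M × ℝ => h q.1) q (⁅liftField X f, liftField Y g⁆ q)
      = dFun (I.prod 𝓘(ℝ, ℝ)) (fun q => dFun (I.prod 𝓘(ℝ, ℝ)) (fun q : M × ℝ => h q.1) q
        (liftField Y g q)) q (liftField X f q) - dFun (I.prod 𝓘(ℝ, ℝ))
        (fun q => dFun (I.prod 𝓘(ℝ, ℝ)) (fun q : M × ℝ => h q.1) q (liftField X f q)) q
        (liftField Y g q) at e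
    rw [lift_fst, lift_fst, ← hv, dFun_comp_fst, dFun_comp_fst, dFun_comp_fst, liftField_apply,
      liftField_apply, prM_prodVec, prM_prodVec, prM_prodVec] at e
    exact e.trans (dFun_mlieBracket h.contMDiff X.smooth Y.smooth q.1).symm
  have e₂ : s = (⁅X, g⁆ - ⁅Y, f⁆ : SFun I M) q.1 := by
    have e := hs contMDiff_snd
    change dFun (I.prod 𝓘(ℝ, ℝ)) Prod.snd q (⁅liftField X f, liftField Y g⁆ q) = _ at e
    rw [lift_snd, lift_snd, ← hv, dFun_comp_fst, dFun_comp_fst, liftField_apply,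
      liftField_apply, prM_prodVec, prM_prodVec] at e
    exact (dt_prodVec q v s).symm.trans e
  rw [e₁, e₂]

/-- The function `e^t h` on `M × ℝ`. -/
def expMul : SFun I M →+ SFun (I.prod 𝓘(ℝ, ℝ)) (M × ℝ) where
  toFun h := ⟨fun q => Real.exp q.2 * h q.1, contMDiff_exp_snd.mul (h.contMDiff.comp contMDiff_fst)⟩
  map_zero' := by ext q; exact mul_zero _
  map_add' h h' := by ext q; exact mul_add _ _ _

theorem expMul_apply (h : SFun I M) (q : M × ℝ) : expMul h q = Real.exp q.2 * h q.1 := rfl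

theorem expMul_injective : Function.Injective (expMul (I := I) (M := M)) := by
  intro h h' e
  ext p
  have := congrArg (fun u : SFun (I.prod 𝓘(ℝ, ℝ)) (M × ℝ) => u (p, 0)) e
  simpa [expMul_apply] using this

/-- The component `f` of the field along `∂/∂t` differentiates `e^t` and returns `f h`. This keeps
all computations on the cone inside the image of `expMul`. -/
theorem lie_expMul (X : SField I M) (f h : SFun I M) :
    ⁅liftField X f, expMul h⁆ = expMul (⁅X, h⁆ + f * h) := by
  ext q
  have e₁ : HasMFDerivAt (I.prod 𝓘(ℝ, ℝ)) 𝓘(ℝ, ℝ) (fun q : M × ℝ => Real.exp q.2) q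
      (Real.exp q.2 • dt I q) := by
    have h := HasMFDerivAt.comp q (Real.hasDerivAt_exp q.2).hasFDerivAt.hasMFDerivAt
      (hasMFDerivAt_snd (I := I) (I' := 𝓘(ℝ, ℝ)) q)
    refine h.congr_mfderiv (ContinuousLinearMap.ext fun v => ?_)
    change (Prod.snd (α := E) (β := ℝ) v) * Real.exp q.2 = Real.exp q.2 * dt I q v
    rw [dt_apply, mul_comm]
  have e₂ : HasMFDerivAt (I.prod 𝓘(ℝ, ℝ)) 𝓘(ℝ, ℝ) (fun q : M × ℝ => h q.1) q
      (dFun (I.prod 𝓘(ℝ, ℝ)) (fun q : M × ℝ => h q.1) q) :=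
    ((h.contMDiff.comp contMDiff_fst).mdifferentiable (by simp) q).hasMFDerivAt
  have e₃ := congrArg (fun L : E × ℝ →L[ℝ] ℝ => L (liftField X f q)) (e₁.mul e₂).mfderiv
  refine Eq.trans e₃ ?_
  change Real.exp q.2 * dFun (I.prod 𝓘(ℝ, ℝ)) (fun q : M × ℝ => h q.1) q (liftField X f q)
    + h q.1 * (Real.exp q.2 * dt I q (liftField X f q)) =
    Real.exp q.2 * ((⁅X, h⁆ : SFun I M) q.1 + f q.1 * h q.1)
  rw [dFun_comp_fst, liftField_apply, prM_prodVec, dt_prodVec, ← lie_sFun_apply]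
  ring

theorem lie_mul_sFun (X : SField I M) (f h : SFun I M) : ⁅X, f * h⁆ = ⁅X, f⁆ * h + f * ⁅X, h⁆ := by
  ext p
  have e₃ := congrArg (fun L : E →L[ℝ] ℝ => L (X p))
    (((f.contMDiff.mdifferentiable (by simp) p).hasMFDerivAt.mul
      (h.contMDiff.mdifferentiable (by simp) p).hasMFDerivAt).mfderiv)
  refine Eq.trans e₃ ?_
  change f p * dFun I h p (X p) + h p * dFun I f p (X p) =
    (⁅X, f⁆ : SFun I M) p * h p + f p * (⁅X, h⁆ : SFun I M) p
  rw [lie_sFun_apply, lie_sFun_apply]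
  ring

/-- The exterior derivative of `e^t (b + dt ∧ a)`. -/
theorem dTwo_expMul {B : SField (I.prod 𝓘(ℝ, ℝ)) (M × ℝ) →+ SField (I.prod 𝓘(ℝ, ℝ)) (M × ℝ) →+
      SFun (I.prod 𝓘(ℝ, ℝ)) (M × ℝ)} {b : SField I M →+ SField I M →+ SFun I M}
    {a : SField I M →+ SFun I M}
    (hB : ∀ X Y f g, B (liftField X f) (liftField Y g) = expMul (b X Y + f * a Y - g * a X))
    (X Y W : SField I M) (f g h : SFun I M) :
    dTwo B (liftField X f) (liftField Y g) (liftField W h) =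
      expMul (dTwo b X Y W + f * (b Y W - dOne a Y W) + g * (b W X - dOne a W X)
        + h * (b X Y - dOne a X Y)) := by
  simp only [dTwo, lie_liftField, hB, lie_expMul, ← map_add, ← map_sub]
  congr 1
  simp only [dOne, lie_add, lie_sub, lie_mul_sFun]
  ring

end
end GenSasaki
end

/-! ### Normal almost contact metric structures and their cones -/

noncomputable section
namespace GenSasaki

open Bundle Set
open scoped Topology

set_option linter.unusedSectionVars false
section
variable {E : Type*} [NormedAddCommGroup E] [NormedSpace ℝ E] [FiniteDimensional ℝ E]
  {H : Type*} [TopologicalSpace H] {I : ModelWithCorners ℝ E H} [I.Boundaryless]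
  {M : Type*} [TopologicalSpace M] [T2Space M] [ChartedSpace H M] [IsManifold I ∞ M]

theorem lieBilinVanishes_iff {b : BilinField I (N := M)} (hb : SmoothOnFields b) (Z : SField I M) :
    LieBilinVanishes I (fun p => Z p) b ↔ ∀ X Y : SField I M,
      ⁅Z, pairTwo b hb X Y⁆ = pairTwo b hb ⁅Z, X⁆ Y + pairTwo b hb X ⁅Z, Y⁆ := by
  have e (X Y : SField I M) (p : M) : lieBilin I (fun p => Z p) b (fun p => X p) (fun p => Y p) p =
    (⁅Z, pairTwo b hb X Y⁆ : SFun I M) p - pairTwo b hb ⁅Z, X⁆ Y p - pairTwo b hb X ⁅Z, Y⁆ p := rfl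
  constructor
  · intro h X Y
    ext p
    have := h _ _ X.smooth Y.smooth p
    rw [e] at this
    change (⁅Z, pairTwo b hb X Y⁆ : SFun I M) p = pairTwo b hb ⁅Z, X⁆ Y p + pairTwo b hb X ⁅Z, Y⁆ p
    linarith
  · intro h X Y hX hY p
    refine (e ⟨X, hX⟩ ⟨Y, hY⟩ p).trans ?_
    rw [h]
    change pairTwo b hb _ _ p + pairTwo b hb _ _ p - _ - _ = 0
    ring

theorem lie_one_sFun (X : SField I M) : ⁅X, (1 : SFun I M)⁆ = 0 := by
  have h := lie_mul_sFun X 1 1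
  rw [mul_one, mul_one, one_mul] at h
  exact left_eq_add.1 h

/-- The exterior derivative of a 2-form, as a 2-form with values in 1-forms. -/
def dTwoHom {V C : Type*} [LieRing V] [CommRing C] [LieRingModule V C] (b : V →+ V →+ C) (X : V) :
    V →+ V →+ C :=
  AddMonoidHom.mk' (fun Y => AddMonoidHom.mk' (fun W => dTwo b X Y W) fun W W' => by
    simp only [dTwo, add_lie, lie_add, map_add, AddMonoidHom.add_apply]; ring) fun Y Y' => by
    ext W
    simp only [AddMonoidHom.mk'_apply, AddMonoidHom.add_apply, dTwo, add_lie, lie_add, map_add]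
    ring

theorem dTwo_neg {V C : Type*} [LieRing V] [CommRing C] [LieRingModule V C] (b : V →+ V →+ C)
    (X Y W : V) : dTwo (-b) X Y W = -dTwo b X Y W := by
  simp only [dTwo, AddMonoidHom.neg_apply, lie_neg]
  ring

theorem dOne_neg {V C : Type*} [LieRing V] [CommRing C] [LieRingModule V C] (a : V →+ C)
    (X Y : V) : dOne (-a) X Y = -dOne a X Y := by
  simp only [dOne, AddMonoidHom.neg_apply, lie_neg]
  ring

theorem dTwo_zero {V C : Type*} [LieRing V] [CommRing C] [LieRingModule V C] (b : V →+ V →+ C)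
    (Y W : V) : dTwo b 0 Y W = 0 := by
  simp [dTwo]

theorem dOne_swap {V C : Type*} [LieRing V] [CommRing C] [LieRingModule V C] (a : V →+ C)
    (X Y : V) : dOne a X Y = -dOne a Y X := by
  simp only [dOne]
  rw [← lie_skew X Y, map_neg]
  ring

theorem dTwo_self {V C : Type*} [LieRing V] [CommRing C] [LieRingModule V C] {b : V →+ V →+ C}
    (hb : ∀ X Y, b X Y = -b Y X) (h : ∀ X, b X X = 0) (X Y : V) : dTwo b X X Y = 0 := by
  simp only [dTwo, lie_self, map_zero, AddMonoidHom.zero_apply, lie_zero, h, hb Y X, lie_neg]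
  rw [← lie_skew Y X, map_neg, AddMonoidHom.neg_apply]
  ring

theorem smoothOnFields_extDerivOne {α : OneForm I (N := M)} (hα : SmoothOneForm I α) :
    SmoothOnFields (extDerivOne I α) := fun X Y =>
  (dOne (pairOne α fun X => hα.apply X.smooth) X Y).contMDiff.congr
    fun p => extDerivOne_eq_dOne hα X Y p

theorem pairTwo_extDerivOne {α : OneForm I (N := M)} (hα : SmoothOneForm I α) (X Y : SField I M) :
    pairTwo (extDerivOne I α) (smoothOnFields_extDerivOne hα) X Y =
      dOne (pairOne α fun X => hα.apply X.smooth) X Y := by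
  ext p; exact extDerivOne_eq_dOne hα X Y p

theorem eq_of_pairTwo_eq {b b' : BilinField I (N := M)} {hb : SmoothOnFields b}
    {hb' : SmoothOnFields b'} (h : ∀ X Y, pairTwo b hb X Y = pairTwo b' hb' X Y) : b = b' := by
  funext p
  refine ContinuousLinearMap.ext fun v => ContinuousLinearMap.ext fun w => ?_
  obtain ⟨X, rfl⟩ := SField.exists_apply_eq p v
  obtain ⟨Y, rfl⟩ := SField.exists_apply_eq p w
  exact congrArg (fun f : SFun I M => f p) (h X Y)

namespace AlmostContactMetric

variable {γ : Bundle.ContMDiffRiemannianMetric I ∞ E (fun p : M => TangentSpace I p)}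

theorem smoothBilinField_inner (γ : Bundle.ContMDiffRiemannianMetric I ∞ E
    (fun p : M => TangentSpace I p)) : SmoothBilinField I γ.inner := γ.contMDiff

variable (A : AlmostContactMetric I γ)

theorem inner_Z_left (p : M) (v : TangentSpace I p) : γ.inner p (A.Z p) v = A.ξ p v := by
  have h := A.metric p (A.Z p) v
  rw [A.F_Z, A.ξ_Z, (γ.inner p).map_zero] at h
  change (0 : ℝ) = _ at h
  linarith

theorem inner_Z_right (p : M) (v : TangentSpace I p) : γ.inner p v (A.Z p) = A.ξ p v := by
  rw [γ.symm, inner_Z_left]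

/-- The compatibility condition on the pair `v`, `Fw`, with `F² w = -w + ξ(w) Z`; the terms in `ξ`
vanish since `ξ ∘ F = 0`. -/
theorem inner_F_left (p : M) (v w : TangentSpace I p) :
    γ.inner p (A.F p v) w = -γ.inner p v (A.F p w) := by
  have h := A.metric p v (A.F p w)
  rw [A.F_sq, A.ξ_F, (γ.inner p _).map_add, (γ.inner p _).map_neg, (γ.inner p _).map_smul,
    A.inner_Z_right, A.ξ_F, smul_zero] at h
  linarith

/-- The vector field `Z` as a smooth section. -/
def ZField : SField I M := ⟨A.Z, A.smooth_Z⟩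

/-- `F` as an operator on smooth vector fields. -/
def FMap : SField I M →+ SField I M := endMap A.F fun X => A.smooth_F.apply X.smooth

/-- `ξ` as an operator on smooth vector fields. -/
def ξMap : SField I M →+ SFun I M := pairOne A.ξ fun X => A.smooth_ξ.apply X.smooth

variable (γ) in
/-- The metric as an operator on smooth vector fields. -/
def metricMap : SField I M →+ SField I M →+ SFun I M :=
  pairTwo γ.inner (smoothBilinField_inner γ).smoothOnFields

theorem smoothOnFields_fundForm : SmoothOnFields A.fundForm := fun X Y =>
  (smoothBilinField_inner γ).apply (A.smooth_F.apply X.smooth) Y.smooth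

/-- `Ξ` as an operator on smooth vector fields. -/
def fundMap : SField I M →+ SField I M →+ SFun I M := pairTwo A.fundForm A.smoothOnFields_fundForm

theorem fundMap_apply (X Y : SField I M) : A.fundMap X Y = metricMap γ (A.FMap X) Y := rfl

theorem FMap_Z : A.FMap A.ZField = 0 := by ext p; exact A.F_Z p

theorem ξMap_Z : A.ξMap A.ZField = 1 := by ext p; exact A.ξ_Z p

theorem ξMap_F (X : SField I M) : A.ξMap (A.FMap X) = 0 := by ext p; exact A.ξ_F p (X p)

theorem metricMap_F (X Y : SField I M) :
    metricMap γ (A.FMap X) (A.FMap Y) = metricMap γ X Y - A.ξMap X * A.ξMap Y := by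
  ext p; exact A.metric p (X p) (Y p)

theorem fundMap_Z (Y : SField I M) : A.fundMap A.ZField Y = 0 := by
  rw [fundMap_apply, FMap_Z, map_zero, AddMonoidHom.zero_apply]

theorem fundMap_swap (X Y : SField I M) : A.fundMap X Y = -A.fundMap Y X := by
  ext p
  change γ.inner p (A.F p (X p)) (Y p) = -γ.inner p (A.F p (Y p)) (X p)
  rw [inner_F_left, γ.symm]

theorem fundMap_F_add (X Y : SField I M) :
    A.fundMap (A.FMap X) Y + A.fundMap X (A.FMap Y) = 0 := by
  rw [A.fundMap_swap (A.FMap X)]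
  ext p
  change -γ.inner p (A.F p (Y p)) (A.F p (X p)) + γ.inner p (A.F p (X p)) (A.F p (Y p)) = 0
  rw [γ.symm]
  ring

/-! ### The almost complex structure of the cone -/

theorem J_prodVec (q : M × ℝ) (v : TangentSpace I q.1) (s : ℝ) :
    A.J q (prodVec q v s) = prodVec q (A.F q.1 v + s • A.Z q.1) (-A.ξ q.1 v) :=
  adaptedJ_apply _ _ _ q v s

theorem J_sq (q : M × ℝ) (v : TangentSpace (I.prod 𝓘(ℝ, ℝ)) q) : A.J q (A.J q v) = -v := by
  obtain ⟨v, s, rfl⟩ := exists_prodVec q v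
  rw [J_prodVec, J_prodVec, (A.F q.1).map_add, (A.F q.1).map_smul, A.F_Z, A.F_sq, (A.ξ q.1).map_add,
    (A.ξ q.1).map_smul, A.ξ_F, A.ξ_Z]
  refine Prod.ext (α := E) (β := ℝ) ?_ ?_
  · have e (a z : E) (x : ℝ) : -a + x • z + s • (0 : E) + (-x) • z = -a := by
      rw [smul_zero, neg_smul]; abel
    exact e v (A.Z q.1) (A.ξ q.1 v)
  · change -(0 + s * 1) = -s
    ring

theorem J_skew (q : M × ℝ) (v w : TangentSpace (I.prod 𝓘(ℝ, ℝ)) q) :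
    coneMetric I γ.inner q (A.J q v) w = -coneMetric I γ.inner q v (A.J q w) := by
  obtain ⟨v, s, rfl⟩ := exists_prodVec q v
  obtain ⟨w, r, rfl⟩ := exists_prodVec q w
  rw [J_prodVec, J_prodVec, coneMetric_apply, coneMetric_apply, (γ.inner q.1).map_add,
    (γ.inner q.1).map_smul, (γ.inner q.1 v).map_add, (γ.inner q.1 v).map_smul, inner_Z_right]
  change _ * (γ.inner q.1 (A.F q.1 v) w + s * γ.inner q.1 (A.Z q.1) w + _) =
    -(_ * (_ + r * _ + _))
  rw [inner_Z_left, inner_F_left]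
  ring

theorem smooth_J (V : SField (I.prod 𝓘(ℝ, ℝ)) (M × ℝ)) :
    SmoothVField (I.prod 𝓘(ℝ, ℝ)) (fun q => A.J q (V q)) := by
  have h₁ : SmoothVField (I.prod 𝓘(ℝ, ℝ)) (fun q : M × ℝ =>
      prodVec q (A.F q.1 (prM I q (V q))) (-A.ξ q.1 (prM I q (V q)))) :=
    smoothVField_prod
      ((A.smooth_F.apply_comp V.smooth.prM).congr fun q => by rw [prM_prodVec])
      ((A.smooth_ξ.apply_comp V.smooth.prM).neg.congr fun q => by rw [dt_prodVec])
  have h₂ : SmoothVField (I.prod 𝓘(ℝ, ℝ)) (fun q => dt I q (V q) • liftField A.ZField 0 q) :=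
    V.smooth.dt.smul_section (liftField A.ZField 0).smooth
  refine (ContMDiff.add_section h₁ h₂).congr fun q => congrArg (Bundle.TotalSpace.mk q) ?_
  obtain ⟨v, s, h⟩ := exists_prodVec q (V q)
  change A.J q (V q) = prodVec q (A.F q.1 (prM I q (V q))) (-A.ξ q.1 (prM I q (V q))) +
    dt I q (V q) • prodVec q (A.Z q.1) 0
  rw [← h, prM_prodVec, dt_prodVec, J_prodVec]
  refine Prod.ext (α := E) (β := ℝ) rfl ?_
  change -A.ξ q.1 v = -A.ξ q.1 v + s * 0
  ring

theorem translationInvariant_J : TranslationInvariant I A.J := by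
  intro s q v
  have e (v : TangentSpace I q.1) (r : ℝ) : mfderiv (I.prod 𝓘(ℝ, ℝ)) (I.prod 𝓘(ℝ, ℝ))
      (fun x : M × ℝ => (x.1, x.2 + s)) q (prodVec q v r) = prodVec (q.1, q.2 + s) v r := by
    have h := (hasMFDerivAt_fst (I := I) (I' := 𝓘(ℝ, ℝ)) q).prodMk
      (HasMFDerivAt.comp q ((hasFDerivAt_id q.2).add_const s).hasMFDerivAt
        (hasMFDerivAt_snd (I := I) (I' := 𝓘(ℝ, ℝ)) q))
    exact congrArg (fun L : E × ℝ →L[ℝ] E × ℝ => L (v, r)) h.mfderiv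
  obtain ⟨v, r, rfl⟩ := exists_prodVec q v
  rw [e, J_prodVec, J_prodVec, e]

/-- The almost complex structure of the cone as an operator on smooth vector fields. -/
def JMap : SField (I.prod 𝓘(ℝ, ℝ)) (M × ℝ) →+ SField (I.prod 𝓘(ℝ, ℝ)) (M × ℝ) :=
  endMap A.J A.smooth_J

/-- `f Z` as a smooth section. -/
def smulZ (f : SFun I M) : SField I M := ⟨fun p => f p • A.Z p, f.contMDiff.smul_section A.smooth_Z⟩

theorem smulZ_one : A.smulZ 1 = A.ZField := by ext p; exact one_smul ℝ (A.Z p)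

theorem smulZ_zero : A.smulZ 0 = 0 := by ext p; exact zero_smul ℝ (A.Z p)

theorem JMap_liftField (X : SField I M) (f : SFun I M) :
    A.JMap (liftField X f) = liftField (A.FMap X + A.smulZ f) (-A.ξMap X) := by
  ext q; exact A.J_prodVec q (X q.1) (f q.1)

theorem liftField_sub (X Y : SField I M) (f g : SFun I M) :
    liftField X f - liftField Y g = liftField (X - Y) (f - g) := by
  ext q; rfl

variable {A}

theorem IsNormal.lie_JMap (hA : A.IsNormal) (V W : SField (I.prod 𝓘(ℝ, ℝ)) (M × ℝ)) :
    ⁅A.JMap V, A.JMap W⁆ - A.JMap ⁅V, A.JMap W⁆ - A.JMap ⁅A.JMap V, W⁆ = ⁅V, W⁆ := by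
  rw [← sub_eq_zero, sub_eq_add_neg]
  ext q
  have h := hA _ _ V.smooth W.smooth q
  unfold nijenhuis at h
  rw [J_sq] at h
  exact h

/-- The Nijenhuis tensor on `∂/∂t` and a lift `Y`: as `J ∂/∂t = Z` and `∂/∂t` commutes with lifts,
it reduces to `[Z, JY] = J[Z, Y]`. The two components are `L_Z F = 0` and `L_Z ξ = 0`. -/
theorem IsNormal.lie_Z (hA : A.IsNormal) (Y : SField I M) :
    ⁅A.ZField, A.FMap Y⁆ = A.FMap ⁅A.ZField, Y⁆ ∧ ⁅A.ZField, A.ξMap Y⁆ = A.ξMap ⁅A.ZField, Y⁆ := by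
  have h := hA.lie_JMap (liftField 0 1) (liftField Y 0)
  simp only [JMap_liftField, lie_liftField, liftField_sub, smulZ_one, smulZ_zero, map_zero,
    lie_zero, zero_lie, lie_one_sFun, sub_zero, add_zero, zero_add, neg_zero, lie_neg] at h
  obtain ⟨h₁, h₂⟩ := liftField_inj h
  exact ⟨sub_eq_zero.1 h₁, by linear_combination -h₂⟩

/-- The `∂/∂t` component of the Nijenhuis tensor on two lifts from `M`. -/
theorem IsNormal.dOne_ξMap_F (hA : A.IsNormal) (X Y : SField I M) :
    dOne A.ξMap (A.FMap X) Y + dOne A.ξMap X (A.FMap Y) = 0 := by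
  have h := hA.lie_JMap (liftField X 0) (liftField Y 0)
  simp only [JMap_liftField, lie_liftField, liftField_sub, smulZ_zero, lie_zero, add_zero, sub_zero,
    lie_neg] at h
  have h₂ := (liftField_inj h).2
  simp only [dOne, ξMap_F, lie_zero]
  linear_combination -h₂

/-! ### Invariance of the metric and of the fundamental form under `Z` -/

theorem lieMetricVanishes_iff : A.LieMetricVanishes ↔ ∀ X Y : SField I M,
    ⁅A.ZField, metricMap γ X Y⁆ = metricMap γ ⁅A.ZField, X⁆ Y + metricMap γ X ⁅A.ZField, Y⁆ :=
  lieBilinVanishes_iff (smoothBilinField_inner γ).smoothOnFields A.ZField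

theorem derivedFormVanishes_iff : A.DerivedFormVanishes ↔ ∀ X Y : SField I M,
    ⁅A.ZField, A.fundMap X Y⁆ = A.fundMap ⁅A.ZField, X⁆ Y + A.fundMap X ⁅A.ZField, Y⁆ :=
  lieBilinVanishes_iff A.smoothOnFields_fundForm A.ZField

theorem IsNormal.derivedFormVanishes_iff_lieMetricVanishes (hA : A.IsNormal) :
    A.DerivedFormVanishes ↔ A.LieMetricVanishes := by
  rw [derivedFormVanishes_iff, lieMetricVanishes_iff]
  constructor
  · intro h X Y
    -- `Ξ(X, FY) = γ(X, Y) - ξ(X) ξ(Y)`, and the product of the `ξ` terms is already `Z`-invariant.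
    have e := h X (A.FMap Y)
    have e' := congrArg (fun u => ⁅A.ZField, u⁆) (A.metricMap_F X Y)
    simp only [fundMap_apply, (hA.lie_Z Y).1, metricMap_F] at e
    simp only [lie_sub, lie_mul_sFun, (hA.lie_Z _).2] at e e'
    linear_combination e
  · intro h X Y
    rw [fundMap_apply, h, (hA.lie_Z X).1]
    rfl

theorem IsNormal.dOne_ξMap_Z (hA : A.IsNormal) (W : SField I M) :
    dOne A.ξMap A.ZField W = 0 := by
  rw [dOne, (hA.lie_Z W).2, ξMap_Z, lie_one_sFun]
  ring

/-- Cartan's formula: `i_Z dΞ = L_Z Ξ - d(i_Z Ξ)`, and `i_Z Ξ = 0` because `FZ = 0`. -/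
theorem dTwo_fundMap_Z (h : A.DerivedFormVanishes) (Y W : SField I M) :
    dTwo A.fundMap A.ZField Y W = 0 := by
  rw [derivedFormVanishes_iff] at h
  rw [dTwo, h Y W, A.fundMap_swap W, A.fundMap_swap _ A.ZField, A.fundMap_swap ⁅W, A.ZField⁆ Y,
    ← lie_skew W A.ZField, map_neg]
  simp only [fundMap_Z, lie_zero, neg_zero]
  ring

/-! ### From the cone equation to the Sasakian condition -/

theorem fundamental_liftField (X Y : SField I M) (f g : SFun I M) :
    ((pairTwo (coneMetric I γ.inner) (smoothOnFields_coneMetric (smoothBilinField_inner γ))).comp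
      A.JMap) (liftField X f) (liftField Y g)
      = expMul (A.fundMap X Y + f * A.ξMap Y - g * A.ξMap X) := by
  change pairTwo _ _ (A.JMap (liftField X f)) (liftField Y g) = _
  rw [JMap_liftField]
  ext q
  refine (coneMetric_apply γ.inner q _ _ _ _).trans ?_
  change _ * (γ.inner q.1 (A.F q.1 (X q.1) + f q.1 • A.Z q.1) (Y q.1) + -A.ξ q.1 (X q.1) * g q.1)
    = Real.exp q.2 * (γ.inner q.1 (A.F q.1 (X q.1)) (Y q.1) + f q.1 * A.ξ q.1 (Y q.1)
      - g q.1 * A.ξ q.1 (X q.1))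
  rw [(γ.inner q.1).map_add, (γ.inner q.1).map_smul]
  change _ * (γ.inner q.1 (A.F q.1 (X q.1)) (Y q.1) + f q.1 * γ.inner q.1 (A.Z q.1) (Y q.1) + _) = _
  rw [inner_Z_left]
  ring

/-- Since `κ ∧ dt = dt ∧ (-κ)`, the form has the shape required by `dTwo_expMul` with `a = -κ`. -/
theorem coneForm_liftField {ψ : BilinField I (N := M)} (hψ : SmoothBilinField I ψ)
    {κ : OneForm I (N := M)} (hκ : SmoothOneForm I κ) (X Y : SField I M) (f g : SFun I M) :
    pairTwo (coneForm I ψ κ) (smoothOnFields_coneForm hψ hκ) (liftField X f) (liftField Y g)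
      = expMul (pairTwo ψ hψ.smoothOnFields X Y
        + f * (-pairOne κ fun X => hκ.apply X.smooth) Y
        - g * (-pairOne κ fun X => hκ.apply X.smooth) X) := by
  ext q
  refine (coneForm_apply ψ κ q _ _ _ _).trans ?_
  change _ = Real.exp q.2 * (ψ q.1 (X q.1) (Y q.1) + f q.1 * -κ q.1 (Y q.1) - g q.1 * -κ q.1 (X q.1))
  ring

/-- The sign `c` is `1` for `J_+` and `-1` for `J_-`. Lifts of fields of `M` suffice as test fields,
and the factor `e^t` drops out by `expMul_injective`. -/
theorem IsNormal.isSasakian_of_dTwo (hA : A.IsNormal) (hL : A.DerivedFormVanishes)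
    {ψ : BilinField I (N := M)} (hψ : IsTwoForm I ψ)
    {κ : OneForm I (N := M)} (hκ : SmoothOneForm I κ) {c : ℤ} (hc : c * c = 1)
    (h : ∀ V₁ V₂ V₃ : SField (I.prod 𝓘(ℝ, ℝ)) (M × ℝ),
      (c : SFun (I.prod 𝓘(ℝ, ℝ)) (M × ℝ)) * dTwo ((pairTwo (coneMetric I γ.inner)
        (smoothOnFields_coneMetric (smoothBilinField_inner γ))).comp A.JMap) V₁ V₂ V₃
      + (dTwo (pairTwo (coneForm I ψ κ) (smoothOnFields_coneForm hψ.smooth hκ)) (A.JMap V₁) V₂ V₃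
        + dTwo (pairTwo (coneForm I ψ κ) (smoothOnFields_coneForm hψ.smooth hκ)) V₁ (A.JMap V₂) V₃
        + dTwo (pairTwo (coneForm I ψ κ) (smoothOnFields_coneForm hψ.smooth hκ)) V₁ V₂ (A.JMap V₃))
          = 0) :
    A.IsSasakian := by
  set k := pairOne κ fun X => hκ.apply X.smooth with hk
  set σ : SField I M →+ SField I M →+ SFun I M := pairTwo ψ hψ.smooth.smoothOnFields +
    pairTwo (extDerivOne I κ) (smoothOnFields_extDerivOne hκ) with hσ
  set β : SField I M →+ SField I M →+ SFun I M := A.fundMap -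
    pairTwo (extDerivOne I A.ξ) (smoothOnFields_extDerivOne A.smooth_ξ) with hβ
  have hσ' (X Y : SField I M) : pairTwo ψ hψ.smooth.smoothOnFields X Y - dOne (-k) X Y = σ X Y := by
    rw [dOne_neg, sub_neg_eq_add, hσ, AddMonoidHom.add_apply, AddMonoidHom.add_apply,
      pairTwo_extDerivOne hκ]
  have hβ' (X Y : SField I M) : A.fundMap X Y - dOne A.ξMap X Y = β X Y := by
    rw [hβ, AddMonoidHom.sub_apply, AddMonoidHom.sub_apply, pairTwo_extDerivOne A.smooth_ξ]
    rfl
  have H (X Y W : SField I M) (f g h' : SFun I M) := h (liftField X f) (liftField Y g) (liftField W h')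
  simp only [JMap_liftField, dTwo_expMul fundamental_liftField,
    dTwo_expMul (coneForm_liftField hψ.smooth hκ), ← hk, hσ', hβ', ← zsmul_eq_mul, ← map_zsmul, ← map_add,
    map_eq_zero_iff _ (expMul_injective (I := I) (M := M))] at H
  have hψ0 (X : SField I M) : pairTwo ψ hψ.smooth.smoothOnFields X X = 0 := by
    ext p; exact hψ.alternating p (X p)
  have hψs (X Y : SField I M) : pairTwo ψ hψ.smooth.smoothOnFields X Y
      = -pairTwo ψ hψ.smooth.smoothOnFields Y X := by
    have e := hψ0 (X + Y)
    simp only [map_add, AddMonoidHom.add_apply, hψ0, zero_add, add_zero] at e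
    linear_combination e
  set τ := dTwoHom (pairTwo ψ hψ.smooth.smoothOnFields) A.ZField with hτ
  have hτ' (Y W : SField I M) :
    dTwo (pairTwo ψ hψ.smooth.smoothOnFields) A.ZField Y W = τ Y W := rfl
  -- The equation on `∂/∂t, Y, W`, where `J ∂/∂t = Z` produces `τ`. The next line takes `Z, Y, W`,
  -- where `JZ = -∂/∂t` produces `-σ` and `dω` drops out by `i_Z dΞ = 0`.
  have dT (Y W : SField I M) := H 0 Y W 1 0 0
  have dZ (Y W : SField I M) := H A.ZField Y W 0 0 0
  simp only [smulZ_one, smulZ_zero, FMap_Z, dTwo_zero, map_zero, AddMonoidHom.zero_apply, ξMap_Z, hτ',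
    dTwo_fundMap_Z hL, zero_add, add_zero, zero_mul, one_mul, mul_zero, neg_zero, smul_zero, zsmul_eq_mul]
    at dT dZ
  have hcc : (c : SFun I M) * c = 1 := by exact_mod_cast congrArg (Int.cast (R := SFun I M)) hc
  have hσs (X Y : SField I M) : σ X Y = -σ Y X := by
    rw [← hσ', ← hσ', dOne_swap, hψs]; ring
  have hβ0 (X Y : SField I M) (h : dOne A.ξMap X Y = A.fundMap X Y) : β X Y = 0 := by
    rw [← hβ', h, sub_self]
  have hσ0 (Y W : SField I M) : σ Y W = 0 := by
    refine eq_zero_of_contact_relations (c := -(c : SFun I M)) (F := A.FMap) (Z := A.ZField)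
      (ξ := A.ξMap) (τ := τ) (β := β) A.FMap_Z (fun Y W => ?_) hσs (fun Y W => ?_) (fun W => ?_)
      (fun W => dTwo_self hψs hψ0 _ W) ?_ (fun Y W => ?_) ?_ (fun Y W => ?_)
      (fun f hf => SFun.eq_zero_of_nsmul 3 three_ne_zero f (by exact_mod_cast hf)) Y W
    · ext p
      have e (B : BilinField I (N := M)) (v w : TangentSpace I p) : B p (A.F p (A.F p v)) w =
          -B p v w + A.ξ p v * B p (A.Z p) w := by
        rw [A.F_sq, (B p).map_add, (B p).map_neg, (B p).map_smul]
        rfl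
      exact e (fun p => ψ p + extDerivOne I κ p) (Y p) (W p)
    · rw [← hβ', ← hβ']
      linear_combination A.fundMap_F_add Y W - hA.dOne_ξMap_F Y W
    · exact hβ0 _ _ (by rw [hA.dOne_ξMap_Z, fundMap_Z])
    · rw [← hσ', dOne_neg, dOne, lie_self, map_zero, hψ0]
      ring
    · linear_combination c * dT Y W - β Y W * hcc
    · linear_combination hcc
    · linear_combination -dZ Y W - A.ξMap Y * hσs W A.ZField
  refine ⟨hA, eq_of_pairTwo_eq (hb := A.smoothOnFields_fundForm)
    (hb' := smoothOnFields_extDerivOne A.smooth_ξ) fun Y W => ?_⟩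
  -- Now `ψ = -dκ`, so `ψ` is closed, and the equation on `∂/∂t` reduces to `c β = 0`.
  have dψ : τ Y W = 0 := dTwo_eq_zero_of_eq_dOne (-k) _
    (fun X Y => by rw [← sub_eq_zero, hσ', hσ0]) _ _ _
  have e := dT Y W
  rw [hσ0, hσ0, dψ] at e
  have hβY : β Y W = 0 := by
    linear_combination c * e - β Y W * hcc
  rw [hβ] at hβY
  exact sub_eq_zero.1 hβY

theorem _root_.GenSasaki.IsTwoForm.swap {ψ : BilinField I (N := M)} (hψ : IsTwoForm I ψ) (p : M)
    (v w : TangentSpace I p) : ψ p v w = -ψ p w v := by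
  have e := hψ.alternating p (v + w)
  have e' : ψ p (v + w) (v + w) = ψ p v v + ψ p w v + (ψ p v w + ψ p w w) := by
    rw [(ψ p _).map_add, (ψ p).map_add]
    rfl
  rw [e', hψ.alternating, hψ.alternating] at e
  linarith

theorem coneMetric_symm (γ : Bundle.ContMDiffRiemannianMetric I ∞ E (fun p : M => TangentSpace I p))
    (q : M × ℝ) (v w : TangentSpace (I.prod 𝓘(ℝ, ℝ)) q) :
    coneMetric I γ.inner q v w = coneMetric I γ.inner q w v := by
  obtain ⟨v, s, rfl⟩ := exists_prodVec q v
  obtain ⟨w, r, rfl⟩ := exists_prodVec q w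
  rw [coneMetric_apply, coneMetric_apply, γ.symm, mul_comm s]

theorem coneForm_swap {ψ : BilinField I (N := M)} (hψ : IsTwoForm I ψ) (κ : OneForm I (N := M))
    (q : M × ℝ) (v w : TangentSpace (I.prod 𝓘(ℝ, ℝ)) q) :
    coneForm I ψ κ q v w = -coneForm I ψ κ q w v := by
  obtain ⟨v, s, rfl⟩ := exists_prodVec q v
  obtain ⟨w, r, rfl⟩ := exists_prodVec q w
  rw [coneForm_apply, coneForm_apply, hψ.swap]
  ring

theorem isMetricField_coneMetric (γ : Bundle.ContMDiffRiemannianMetric I ∞ E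
    (fun p : M => TangentSpace I p)) : IsMetricField (coneMetric I γ.inner) where
  symm := coneMetric_symm γ
  pos q v hv := by
    obtain ⟨v, s, rfl⟩ := exists_prodVec q v
    rw [coneMetric_apply]
    refine mul_pos (Real.exp_pos _) ?_
    by_cases h : v = 0
    · have hs : s ≠ 0 := by
        rintro rfl
        exact hv (by rw [h]; rfl)
      rw [h, (γ.inner q.1).map_zero]
      exact add_pos_of_nonneg_of_pos le_rfl (mul_self_pos.2 hs)
    · exact add_pos_of_pos_of_nonneg (γ.pos q.1 v h) (mul_self_nonneg s)
  smooth := smoothOnFields_coneMetric (smoothBilinField_inner γ)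

theorem isMetricField_inner (γ : Bundle.ContMDiffRiemannianMetric I ∞ E
    (fun p : M => TangentSpace I p)) : IsMetricField γ.inner :=
  ⟨γ.symm, γ.pos, (smoothBilinField_inner γ).smoothOnFields⟩

/-- The 1-form `e^t ξ` of `M × ℝ`. -/
def coneContact (A : AlmostContactMetric I γ) : OneForm (I.prod 𝓘(ℝ, ℝ)) (N := M × ℝ) := fun q =>
  Real.exp q.2 • (A.ξ q.1).comp (prM I q)

theorem smoothOneForm_coneContact : SmoothOneForm (I.prod 𝓘(ℝ, ℝ)) A.coneContact :=
  smoothOneForm_of_apply fun _ hX => contMDiff_exp_snd.mul (A.smooth_ξ.apply_comp hX.prM)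

theorem IsSasakian.fundMap_eq (hA : A.IsSasakian) (X Y : SField I M) :
    A.fundMap X Y = dOne A.ξMap X Y := by
  ext p
  refine Eq.trans ?_ (extDerivOne_eq_dOne A.smooth_ξ X Y p)
  rw [← hA.contact]
  rfl

/-- The fundamental form of the cone over a Sasakian manifold is `d(e^t ξ)`. -/
theorem IsSasakian.fundamental_cone (hA : A.IsSasakian) (q : M × ℝ)
    (v w : TangentSpace (I.prod 𝓘(ℝ, ℝ)) q) :
    coneMetric I γ.inner q (A.J q v) w = extDerivOne (I.prod 𝓘(ℝ, ℝ)) A.coneContact q v w := by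
  obtain ⟨v, s, rfl⟩ := exists_prodVec q v
  obtain ⟨w, r, rfl⟩ := exists_prodVec q w
  obtain ⟨X, rfl⟩ := SField.exists_apply_eq q.1 v
  obtain ⟨Y, rfl⟩ := SField.exists_apply_eq q.1 w
  -- The identity is pointwise, so the `∂/∂t` components may be extended as constants, whose
  -- derivatives vanish.
  let f : SFun I M := ⟨fun _ => s, contMDiff_const⟩
  let g : SFun I M := ⟨fun _ => r, contMDiff_const⟩
  have hf (X : SField I M) : ⁅X, f⁆ = 0 := by
    ext p
    exact congrArg (fun L : E →L[ℝ] ℝ => L (X p)) (mfderiv_const (c := s))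
  refine Eq.trans (congrArg (fun u : SFun (I.prod 𝓘(ℝ, ℝ)) (M × ℝ) => u q)
    (A.fundamental_liftField X Y f g)) (Eq.trans ?_ (extDerivOne_eq_dOne
      A.smoothOneForm_coneContact (liftField X f) (liftField Y g) q).symm)
  have e (X : SField I M) (f : SFun I M) :
      pairOne A.coneContact (fun V => A.smoothOneForm_coneContact.apply V.smooth) (liftField X f)
        = expMul (A.ξMap X) := by
    ext q
    change Real.exp q.2 * A.ξ q.1 (prM I q (prodVec q (X q.1) (f q.1))) = _
    rw [prM_prodVec]
    rfl
  simp only [dOne, lie_liftField, e, lie_expMul, hA.fundMap_eq, ← map_sub]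
  refine congrArg (fun u => expMul u q) ?_
  ring

theorem IsSasakian.isKahlerField (hA : A.IsSasakian) :
    IsKahlerField (coneMetric I γ.inner) (isMetricField_coneMetric γ).smooth A.J where
  smooth := A.smooth_J
  sq := A.J_sq
  skew := A.J_skew
  integrable := hA.normal
  closed X Y W := by
    refine dTwo_eq_zero_of_eq_dOne (pairOne A.coneContact
      (fun V => A.smoothOneForm_coneContact.apply V.smooth)) _ (fun X Y => ?_) X Y W
    ext q
    exact (hA.fundamental_cone q (X q) (Y q)).trans
      (extDerivOne_eq_dOne A.smoothOneForm_coneContact X Y q)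

set_option synthInstance.maxHeartbeats 400000 in
theorem isTwoForm_zero : IsTwoForm I (fun _ : M => 0) where
  alternating _ _ := rfl
  smooth := Bundle.contMDiff_zeroSection ℝ
    (fun p : M => TangentSpace I p →L[ℝ] TangentSpace I p →L[ℝ] ℝ)

variable {A' : AlmostContactMetric I γ}

/-- The witnesses are `ψ = 0` and `κ = 0`; both cones are Kähler for the same metric. -/
theorem IsSasakian.correspondsToGenSasakian (hA : A.IsSasakian) (hA' : A'.IsSasakian) :
    CorrespondsToGenSasakian I A A' := by
  refine ⟨fun _ => 0, fun _ => 0, _, _, _, isTwoForm_zero,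
    smoothOneForm_of_apply fun _ _ => contMDiff_const, (isMetricField_inner γ).isGenMetricOf, ?_,
    isGenKahler_bigEndOf (isMetricField_coneMetric γ) hA.isKahlerField hA'.isKahlerField, ?_,
    A.translationInvariant_J, A'.translationInvariant_J⟩
  · rw [coneForm_zero]
    exact (isMetricField_coneMetric γ).isGenMetricOf
  · rw [coneForm_zero]
    exact isInducedPair_bigEndOf (isMetricField_coneMetric γ) _ _

theorem isSasakian_of_corresponds (h : CorrespondsToGenSasakian I A A')
    (hA : A.IsNormal) (hA' : A'.IsNormal) (hL : A.DerivedFormVanishes)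
    (hL' : A'.DerivedFormVanishes) : A.IsSasakian ∧ A'.IsSasakian := by
  obtain ⟨ψ, κ, S, St, 𝒥, h⟩ := h
  have hs := smoothOnFields_coneMetric (smoothBilinField_inner γ)
  refine ⟨hA.isSasakian_of_dTwo hL h.form h.smooth_κ (c := 1) rfl fun V₁ V₂ V₃ => ?_,
    hA'.isSasakian_of_dTwo hL' h.form h.smooth_κ (c := -1) rfl fun V₁ V₂ V₃ => ?_⟩
  · rw [Int.cast_one, one_mul]
    refine h.kahler.dTwo_fundamental (ε := 1) (smoothOnFields_coneForm h.form.smooth h.smooth_κ) hs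
      (coneForm_swap h.form κ) (coneMetric_symm γ) A.smooth_J A.J_sq A.J_skew (.inl rfl)
      h.induced.plus (fun q v => ?_) (fun q v => ?_) V₁ V₂ V₃
    · exact (h.cone.eigen_plus q v).trans (one_smul ℝ _).symm
    · exact (h.cone.eigen_minus q v).trans (neg_one_smul ℝ _).symm
  · rw [Int.cast_neg, Int.cast_one, neg_one_mul, ← dTwo_neg]
    -- `V_-` is the graph of `Ψ + (-Γ)`, so the same result applies with metric `-Γ` and eigenvalue
    -- `-1`. The fundamental form changes sign, which is the reason for `c = -1`.
    refine h.kahler.dTwo_fundamental (ε := -1) (γ := fun q => -coneMetric I γ.inner q)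
      (smoothOnFields_coneForm h.form.smooth h.smooth_κ) (fun V W => (hs V W).neg)
      (coneForm_swap h.form κ) (fun q v w => congrArg Neg.neg (coneMetric_symm γ q v w)) A'.smooth_J
      A'.J_sq (fun q v w => congrArg Neg.neg (A'.J_skew q v w)) (.inr rfl)
      (fun q v => ?_) (fun q v => ?_) (fun q v => ?_) V₁ V₂ V₃
    · have e := h.induced.minus q v
      simp only [graphMinus, sub_eq_add_neg] at e
      exact e
    · have e := (h.cone.eigen_minus q v).trans (neg_one_smul ℝ _).symm
      simp only [graphMinus, sub_eq_add_neg] at e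
      exact e
    · have e := (h.cone.eigen_plus q v).trans (one_smul ℝ _).symm
      rw [neg_neg (1 : ℝ)]
      change _ = (1 : ℝ) • (v, coneForm I ψ κ q v - -coneMetric I γ.inner q v)
      change St q (v, coneForm I ψ κ q v - -coneMetric I γ.inner q v) = _
      rw [sub_neg_eq_add]
      exact e

end AlmostContactMetric
end
end GenSasaki
end

theorem corollary3p2 {E : Type*} [NormedAddCommGroup E] [NormedSpace ℝ E] [FiniteDimensional ℝ E]
    {M : Type*} [TopologicalSpace M] [T2Space M] [SecondCountableTopology M]
    [ChartedSpace E M] [IsManifold 𝓘(ℝ, E) ∞ M]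
    (γ : Bundle.ContMDiffRiemannianMetric 𝓘(ℝ, E) ∞ E (fun p : M => TangentSpace 𝓘(ℝ, E) p))
    (Ap Am : GenSasaki.AlmostContactMetric 𝓘(ℝ, E) γ)
    (hp : Ap.IsNormal) (hm : Am.IsNormal) :
    (Ap.DerivedFormVanishes ↔ Ap.LieMetricVanishes) ∧
    (Am.DerivedFormVanishes ↔ Am.LieMetricVanishes) ∧
    (Ap.DerivedFormVanishes → Am.DerivedFormVanishes →
      (GenSasaki.CorrespondsToGenSasakian 𝓘(ℝ, E) Ap Am ↔ Ap.IsSasakian ∧ Am.IsSasakian)) := by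
  exact ⟨hp.derivedFormVanishes_iff_lieMetricVanishes, hm.derivedFormVanishes_iff_lieMetricVanishes,
    fun hLp hLm => ⟨fun h => GenSasaki.AlmostContactMetric.isSasakian_of_corresponds h hp hm hLp hLm,
      fun h => h.1.correspondsToGenSasakian h.2⟩⟩
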